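/- Let $q>1$ be real and let $\tilde{\mathbb C}^*$ be the Riemann surface of the logarithm, with $\tilde D_R=\{x\in\tilde{\mathbb C}^*:|x|<R\}$ and $V_\varepsilon=\{\xi\in\tilde{\mathbb C}^*:|\arg\xi|<\varepsilon\}$. For $k>0$ put $p=q^{1/k}$ and define: - the formal $q$-Borel transform $\hat{\mathcal B}_{q;k}\big(\sum a_nx^n\big)=\sum a_n\,p^{-n(n-1)/2}\xi^n$; - $\mathbb E_{q;k}^0$, the space of functions $\phi$ analytic on some $V_\varepsilon$, $\varepsilon>0$, such that for some $A,R>0$ both $|\phi(\xi)|$ on $\{\xi\in V_\varepsilon:|\xi|\le R\}$ and $|\phi(\xi)|\,e^{-(\log|A\xi|)^2/(2\log p)}$ on $\{\xi\in V_\varepsilon:|\xi|>R\}$ are bounded; - for $\phi\in\mathbb E^0_{q;k}$ and $x\in\tilde{\mathbb C}^*$ with $|x|$ small, $$\mathcal L_{q;k}^0(\phi)(x)=\frac1{\sqrt{2\pi\log p}}\int_0^{\infty}e^{-(\log\frac{x}{\sqrt p\,\xi})^2/(2\log p)}\,\phi(\xi)\,\frac{d\xi}\xi .$$ For a finite strictly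 increasing sequence $\vec s=(s_1,\dots,s_r)$ of positive rationals put $\tilde s_i=\big(\frac1{s_i}-\frac1{s_{i+1}}\big)^{-1}$ with $s_{r+1}=\infty$. A series $f\in\mathbb C[[x]]$ belongs to $\mathbb C[[x]]_{q;\vec s}^0$ if $\hat{\mathcal B}_{q;s_1}(f)$ converges near $0$, its germ continues analytically along the direction $0$ to an element of $\mathbb E^0_{q;\tilde s_1}$, and for $1\le j<r$ the $\mathcal L^0_{q;\tilde s_j}$-transform of the function obtained at stage $j$ continues along the direction $0$ to an element of $\mathbb E^0_{q;\tilde s_{j+1}}$. Its $q$-multisum $\mathcal S^0_{q;\vec s}(f)$ is the last transform, by $\mathcal L^0_{q;\tilde s_r}$. For the empty sequence, $\mathbb C[[x]]^0_{q;\varnothing}$ is the set of convergent series and $\mathcal S^0_{q;\varnothing}$ is the usual sum. Let $\mathbb C[[x]]_q^0=\bigcup_{\vec s}\mathbb C[[x]]_{q;\vec s}^0$; a $q$-sum $\mathcal S_q^0(f)$ of $f\in\mathbb C[[x]]_q^0$ is $\mathcal S^0_{q;\vec s}(f)$ for any $\vec s$ with $f\in\mathbb C[[x]]_{q;\vec s}^0$.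 Let $E_{1,q}=\sum_{n\ge0}(-1)^nq^{n(n-1)/2}x^n$ be the $q$-Euler series. Equalities with an inverse are equalities of meromorphic functions on $\tilde D_R$ for some $R>0$. **Theorem.** One has $E_{1,q}\in\mathbb C[[x]]^0_{q;(1)}$. For every finite strictly increasing sequence $\vec s$ of positive rational numbers, there is no power series $f\in\mathbb C[[x]]^0_{q;\vec s}$ such that $\mathcal S^0_{q;\vec s}(f)=\big(\mathcal S^0_{q;1}(E_{1,q})\big)^{-1}$. Consequently, if the inverse series $E_{1,q}^{-1}$ belongs to $\mathbb C[[x]]^0_q$, then $\mathcal S^0_q(E_{1,q}^{-1})\ne\mathcal S^0_q(E_{1,q})^{-1}$, whichever sequences are used to compute the two $q$-sums. -/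

import Mathlib

namespace QSummation

/-- The Riemann surface of the logarithm. A point `x` is represented by its logarithm
`log x = log |x| + i arg x`, which is a global biholomorphic coordinate with values in `ℂ`;
`σ_q` is the translation by `log q`. -/
abbrev LogSurface : Type := ℂ

/-- `|x|`. -/
noncomputable def modulus (x : LogSurface) : ℝ := Real.exp x.re

/-- `arg x`, a real number (not taken modulo `2π`). -/
def argument (x : LogSurface) : ℝ := x.im

/-- The projection of the Riemann surface of the logarithm onto `ℂ ∖ {0}`. -/
noncomputable def proj (x : LogSurface) : ℂ := Complex.exp x

/-- The punctured disc `{x : |x| < R}` on the Riemann surface of the logarithm. -/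
def disc (R : ℝ) : Set LogSurface := {x | modulus x < R}

/-- The open sector `{x : |arg x - d| < ε}`. -/
def sector (d ε : ℝ) : Set LogSurface := {x | |argument x - d| < ε}

/-- `q^{1/k}`: the transforms and spaces of order `k` for `q` are those of order one for
`q^{1/k}`. -/
noncomputable def base (q k : ℝ) : ℝ := q ^ (1 / k)

/-- The formal `q`-Borel transform of order `k`: `∑ aₙ xⁿ ↦ ∑ aₙ p^{-n(n-1)/2} ξⁿ` with
`p = q^{1/k}`. -/
noncomputable def formalBorel (q k : ℝ) (f : PowerSeries ℂ) : PowerSeries ℂ :=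
  PowerSeries.mk fun n => PowerSeries.coeff n f / (base q k : ℂ) ^ (n * (n - 1) / 2)

/-- `f ∈ ℂ{x}`: the radius of convergence is strictly positive. -/
def IsConvergent (f : PowerSeries ℂ) : Prop :=
  ∃ r : ℝ, 0 < r ∧ ∀ z : ℂ, ‖z‖ < r → Summable fun n : ℕ => PowerSeries.coeff n f * z ^ n

/-- The sum of a convergent power series, as a function on the Riemann surface of the logarithm
(to be used near `0` only). -/
noncomputable def seriesSum (f : PowerSeries ℂ) (x : LogSurface) : ℂ :=
  ∑' n : ℕ, PowerSeries.coeff n f * proj x ^ n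

/-- The space `𝔼_{q;k}^d`: analytic functions on some sector `|arg ξ - d| < ε`, bounded for
`|ξ| ≤ R` and of `q`-exponential growth `exp ((log |A ξ|)² / (2 log q^{1/k}))` for `|ξ| > R`. -/
def MemE (q k d : ℝ) (φ : LogSurface → ℂ) : Prop :=
  ∃ ε : ℝ, 0 < ε ∧ DifferentiableOn ℂ φ (sector d ε) ∧
    ∃ A : ℝ, 0 < A ∧ ∃ R : ℝ, 0 < R ∧ ∃ C : ℝ,
      (∀ ξ ∈ sector d ε, modulus ξ ≤ R → ‖φ ξ‖ ≤ C) ∧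
      (∀ ξ ∈ sector d ε, R < modulus ξ →
        ‖φ ξ‖ * Real.exp (-(Real.log (A * modulus ξ)) ^ 2 / (2 * Real.log (base q k))) ≤ C)

/-- The `q`-Laplace transform of order `k` in the direction `d`; with `p = q^{1/k}`,
`(2π log p)^{-1/2} ∫_0^{∞ e^{id}} exp (-(log (x / (√p ξ)))² / (2 log p)) φ(ξ) dξ/ξ`.
The half-line is parametrised by `log ξ = t + i d`, `t ∈ ℝ`, so that `dξ/ξ = dt`. -/
noncomputable def laplace (q k d : ℝ) (φ : LogSurface → ℂ) (x : LogSurface) : ℂ :=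
  1 / (Real.sqrt (2 * Real.pi * Real.log (base q k)) : ℂ) *
    ∫ t : ℝ, Complex.exp
        (-(x - (Real.log (base q k) : ℂ) / 2 - ((t : ℂ) + (d : ℂ) * Complex.I)) ^ 2 /
          (2 * (Real.log (base q k) : ℂ))) *
      φ ((t : ℂ) + (d : ℂ) * Complex.I)

/-- `φ` coincides with `g` near `0` in the direction `d`, that is on the points of small modulus
of some sector around `d`. For `φ` analytic in a sector around `d` this says that `φ` is the
analytic continuation of `g` along the direction `d`. -/
def Continues (d : ℝ) (g φ : LogSurface → ℂ) : Prop :=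
  ∃ ε : ℝ, 0 < ε ∧ ∃ R : ℝ, 0 < R ∧ ∀ ξ ∈ sector d ε ∩ disc R, φ ξ = g ξ

/-- `s̃_i = 1 / (1/s_i - 1/s_{i+1})`, with the convention `s_{r+1} = ∞`. -/
def tilde : List ℚ → List ℚ
  | [] => []
  | [s] => [s]
  | s :: s' :: l => 1 / (1 / s - 1 / s') :: tilde (s' :: l)

/-- Iterated `q`-Laplace transforms of orders `k₁, …, k_r` in the direction `d`, starting from a
germ `g`: at each stage the germ continues along `d` to an element `φ` of `𝔼_{q;k_j}^d`, to which
the `q`-Laplace transform of order `k_j` is applied. The last transform is `F`. -/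
def IsIteratedLaplace (q d : ℝ) : List ℚ → (LogSurface → ℂ) → (LogSurface → ℂ) → Prop
  | [], g, F => F = g
  | k :: l, g, F => ∃ φ : LogSurface → ℂ, MemE q k d φ ∧ Continues d g φ ∧
      IsIteratedLaplace q d l (laplace q k d φ) F

/-- `f ∈ ℂ[[x]]_{q;s}^d` and its `q`-multisum is `F`, that is
`F = 𝓛_{q;s̃_r}^d ∘ ⋯ ∘ 𝓛_{q;s̃_1}^d ∘ 𝓒^d ∘ 𝓑̂_{q;s_1} (f)`.
For the empty sequence, `f` is a convergent series and `F` is its sum. -/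
def IsQMultisum (q d : ℝ) : List ℚ → PowerSeries ℂ → (LogSurface → ℂ) → Prop
  | [], f, F => IsConvergent f ∧ F = seriesSum f
  | s₁ :: l, f, F => IsConvergent (formalBorel q s₁ f) ∧
      IsIteratedLaplace q d (tilde (s₁ :: l)) (seriesSum (formalBorel q s₁ f)) F

/-- `f ∈ ℂ[[x]]_{q;s}^d`. -/
def IsQMultisummable (q d : ℝ) (s : List ℚ) (f : PowerSeries ℂ) : Prop :=
  ∃ F : LogSurface → ℂ, IsQMultisum q d s f F

/-- Finite strictly increasing sequences of positive rational numbers. -/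
def IsOrder (s : List ℚ) : Prop := s.Pairwise (· < ·) ∧ ∀ a ∈ s, 0 < a

/-- `f ∈ ℂ[[x]]_q^d`, the union of the spaces `ℂ[[x]]_{q;s}^d`, and `F` is a `q`-sum of `f` in the
direction `d`. -/
def IsQSum (q d : ℝ) (f : PowerSeries ℂ) (F : LogSurface → ℂ) : Prop :=
  ∃ s : List ℚ, IsOrder s ∧ IsQMultisum q d s f F

/-- The `q`-Euler series `E_{1,q} = ∑ (-1)ⁿ q^{n(n-1)/2} xⁿ`, the formal solution of
`x σ_q y + y = 1`. -/
noncomputable def qEuler (q : ℝ) : PowerSeries ℂ :=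
  PowerSeries.mk fun n => (-1) ^ n * (q : ℂ) ^ (n * (n - 1) / 2)

/-- `F = 1/G` as meromorphic functions near `0` on the Riemann surface of the logarithm:
on some `{|x| < R}`, equality of the values away from the zeros of `G`. -/
def EqInvNearZero (F G : LogSurface → ℂ) : Prop :=
  ∃ R : ℝ, 0 < R ∧ ∀ x ∈ disc R, G x ≠ 0 → F x = (G x)⁻¹

theorem sector_mono {d ε ε' : ℝ} (h : ε ≤ ε') : sector d ε ⊆ sector d ε' :=
  fun _ hx => lt_of_lt_of_le hx h

theorem isOpen_sector (d ε : ℝ) : IsOpen (sector d ε) :=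
  isOpen_lt (by unfold argument; fun_prop) continuous_const

theorem isOpen_disc (R : ℝ) : IsOpen (disc R) :=
  isOpen_lt (by unfold modulus; fun_prop) continuous_const

theorem convex_sector (d ε : ℝ) : Convex ℝ (sector d ε) := by
  have h : sector d ε = Complex.imLm ⁻¹' Metric.ball d ε := by
    ext x
    simp [sector, argument, Real.dist_eq]
  rw [h]
  exact (convex_ball d ε).linear_preimage Complex.imLm

/-- The continuation of a germ along a direction is unique there. -/
theorem Continues.eq_on_line {q k d : ℝ} {g φ ψ : LogSurface → ℂ} (hφ : MemE q k d φ)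
    (hψ : MemE q k d ψ) (cφ : Continues d g φ) (cψ : Continues d g ψ) (t : ℝ) :
    φ ((t : ℂ) + (d : ℂ) * Complex.I) = ψ ((t : ℂ) + (d : ℂ) * Complex.I) := by
  obtain ⟨ε₁, h₁, D₁, -⟩ := hφ
  obtain ⟨ε₂, h₂, D₂, -⟩ := hψ
  obtain ⟨ε₃, h₃, R₃, hR₃, e₃⟩ := cφ
  obtain ⟨ε₄, h₄, R₄, hR₄, e₄⟩ := cψ
  have hline : ∀ (t ε : ℝ), 0 < ε → (t : ℂ) + (d : ℂ) * Complex.I ∈ sector d ε := by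
    intro t ε hε
    simpa [sector, argument] using hε
  set z₀ : ℂ := ((Real.log (min R₃ R₄ / 2) : ℝ) : ℂ) + (d : ℂ) * Complex.I with hz₀
  have hm : 0 < min R₃ R₄ := lt_min hR₃ hR₄
  have hz₀' : modulus z₀ < min R₃ R₄ := by
    simp only [modulus, hz₀]
    simp [Real.exp_log (half_pos hm)]
    constructor <;> linarith [min_le_left R₃ R₄, min_le_right R₃ R₄]
  have hA₁ : AnalyticOnNhd ℂ φ (sector d (min ε₁ ε₂)) :=
    (D₁.mono (sector_mono (min_le_left _ _))).analyticOnNhd (isOpen_sector _ _)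
  have hA₂ : AnalyticOnNhd ℂ ψ (sector d (min ε₁ ε₂)) :=
    (D₂.mono (sector_mono (min_le_right _ _))).analyticOnNhd (isOpen_sector _ _)
  refine hA₁.eqOn_of_preconnected_of_eventuallyEq hA₂ (convex_sector _ _).isPreconnected
    (hline _ _ (lt_min h₁ h₂) : z₀ ∈ _) ?_ (hline t _ (lt_min h₁ h₂))
  filter_upwards [(isOpen_sector d ε₃).mem_nhds (hline _ _ h₃ : z₀ ∈ _),
    (isOpen_sector d ε₄).mem_nhds (hline _ _ h₄ : z₀ ∈ _),
    (isOpen_disc (min R₃ R₄)).mem_nhds hz₀'] with x x₃ x₄ xR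
  rw [e₃ x ⟨x₃, show modulus x < R₃ from lt_of_lt_of_le xR (min_le_left _ _)⟩,
    e₄ x ⟨x₄, show modulus x < R₄ from lt_of_lt_of_le xR (min_le_right _ _)⟩]

theorem IsIteratedLaplace.unique {q d : ℝ} : ∀ {l : List ℚ} {g F F' : LogSurface → ℂ},
    IsIteratedLaplace q d l g F → IsIteratedLaplace q d l g F' → F = F'
  | [], _, _, _, h, h' => h.trans h'.symm
  | k :: l, g, F, F', ⟨φ, m, c, h⟩, ⟨φ', m', c', h'⟩ => by
    have e : laplace q k d φ = laplace q k d φ' := by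
      funext x
      simp only [laplace, Continues.eq_on_line m m' c c']
    rw [e] at h
    exact h.unique h'

/-- The `q`-multisum of a given order is unique. -/
theorem IsQMultisum.unique {q d : ℝ} {s : List ℚ} {f : PowerSeries ℂ} {F F' : LogSurface → ℂ}
    (h : IsQMultisum q d s f F) (h' : IsQMultisum q d s f F') : F = F' := by
  cases s with
  | nil => exact h.2.trans h'.2.symm
  | cons s l => exact h.2.unique h'.2

end QSummation

/-! In the coordinate `log x`, the `q`-Laplace transform of order `k` is a Gaussian convolution of
variance `P = log q / k`. It maps functions of admissible growth to functions holomorphic near `0`,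
so every `q`-multisum is continuous on some disc of the Riemann surface of the logarithm
(`IsQMultisum.continuousOn`). An inverse of the `q`-sum of the `q`-Euler series would therefore
force that sum to be zero-free near `0`.

It is not zero-free. The sum `eulerSum` is the Gaussian transform of `1 / (1 + ξ)`, and it is entire
in `log x`. Moving the contour across the pole of the integrand at `-πi` shows that one turn around
`0` adds an explicit Gaussian (`eulerSum_add_two_pi_I`). After many turns the sum is `1` plus a
small error plus a sum of such jumps, and the last jump dominates the others. The jump takes the
value `-1` at points with `re → -∞` and `im → +∞`, and a quantitative open mapping argument finds a
true zero near each of them (`exists_eulerSum_eq_zero`).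

For arbitrary sequences, every `q`-sum of the `q`-Euler series must also be `eulerSum`
(`IsQMultisum.eq_eulerSum`). With `L = log q`, orders `s₁ > 1` leave the Borel transform divergent.
At an order `s < 1` the function is a partial theta function of parameter `L(1/s - 1)`. It grows too
fast for the process to stop there or to jump past the order `1` (`not_partialTheta_growth`), so `1`
occurs in the sequence. From then on, the addition of Gaussian variances gives the same sum for
every sequence (`gaussTransform_gaussTransform`). -/

namespace QSummation

open MeasureTheory Filter Topology

/-! ### Gaussian kernels and their exponential moments -/

/-- The kernel of the `q`-Laplace transform for `log p = P`, in logarithmic coordinates. -/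
noncomputable def gaussKernel (P : ℝ) (x t : ℂ) : ℂ :=
  Complex.exp (-(x - (P : ℂ) / 2 - t) ^ 2 / (2 * (P : ℂ)))

/-- The `q`-Laplace transform in the direction `0` for `log p = P`. -/
noncomputable def gaussTransform (P : ℝ) (φ : ℂ → ℂ) (x : ℂ) : ℂ :=
  1 / (Real.sqrt (2 * Real.pi * P) : ℂ) * ∫ t : ℝ, gaussKernel P x t * φ t

theorem log_base {q : ℝ} (hq : 0 < q) (k : ℝ) : Real.log (base q k) = Real.log q / k := by
  rw [base, Real.log_rpow hq]; ring

theorem laplace_zero {q : ℝ} (hq : 0 < q) (k : ℝ) (φ : LogSurface → ℂ) :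
    laplace q k 0 φ = gaussTransform (Real.log q / k) φ := by
  funext x
  simp only [laplace, gaussTransform, gaussKernel, log_base hq]
  simp

theorem gaussTransform_congr {P : ℝ} {φ ψ : ℂ → ℂ} (h : ∀ t : ℝ, φ t = ψ t) :
    gaussTransform P φ = gaussTransform P ψ := by
  funext x
  simp only [gaussTransform, h]

theorem norm_gaussKernel (P : ℝ) (x : ℂ) (t : ℝ) :
    ‖gaussKernel P x t‖ = Real.exp ((x.im ^ 2 - (x.re - P / 2 - t) ^ 2) / (2 * P)) := by
  rw [gaussKernel, Complex.norm_exp]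
  congr 1
  have : -(x - (P : ℂ) / 2 - t) ^ 2 / (2 * (P : ℂ)) =
      (-(x - ((P / 2 + t : ℝ) : ℂ)) ^ 2) / ((2 * P : ℝ) : ℂ) := by
    push_cast; ring
  rw [this, Complex.div_ofReal_re]
  congr 1
  simp [pow_two]
  ring

theorem gaussKernel_mul_exp_eq {P : ℝ} (hP : 0 < P) (x c t : ℂ) :
    gaussKernel P x t * Complex.exp (c * t) =
      Complex.exp (-(1 / (2 * (P : ℂ))) * t ^ 2 + ((x - P / 2) / P + c) * t +
        -(x - P / 2) ^ 2 / (2 * P)) := by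
  have : (P : ℂ) ≠ 0 := by exact_mod_cast hP.ne'
  rw [gaussKernel, ← Complex.exp_add]
  congr 1
  field_simp
  ring

theorem neg_one_div_re {P : ℝ} (hP : 0 < P) : (-(1 / (2 * (P : ℂ)))).re < 0 := by
  have : (-(1 / (2 * (P : ℂ)))) = ((-(1 / (2 * P)) : ℝ) : ℂ) := by push_cast; ring
  rw [this, Complex.ofReal_re]
  simpa using by positivity

theorem integrable_gaussKernel_mul_exp {P : ℝ} (hP : 0 < P) (x c : ℂ) :
    Integrable fun t : ℝ => gaussKernel P x t * Complex.exp (c * t) := by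
  simp only [gaussKernel_mul_exp_eq hP]
  exact integrable_cexp_quadratic' (neg_one_div_re hP) _ _

theorem integrable_gaussKernel {P : ℝ} (hP : 0 < P) (x : ℂ) :
    Integrable fun t : ℝ => gaussKernel P x t := by
  simpa using integrable_gaussKernel_mul_exp hP x 0

theorem ofReal_cpow_half {a : ℝ} (ha : 0 ≤ a) : (a : ℂ) ^ (1 / 2 : ℂ) = (Real.sqrt a : ℂ) := by
  rw [Real.sqrt_eq_rpow, Complex.ofReal_cpow ha]
  norm_num

/-- Completing the square. For `c = n` this is the rule `ξⁿ ↦ p^{n(n-1)/2} xⁿ`, by which the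
`q`-Laplace transform inverts the formal `q`-Borel transform. -/
theorem integral_gaussKernel_mul_exp {P : ℝ} (hP : 0 < P) (x c : ℂ) :
    ∫ t : ℝ, gaussKernel P x t * Complex.exp (c * t) =
      (Real.sqrt (2 * Real.pi * P) : ℂ) * Complex.exp (c * x + P * (c * (c - 1) / 2)) := by
  have hP' : (P : ℂ) ≠ 0 := by exact_mod_cast hP.ne'
  simp only [gaussKernel_mul_exp_eq hP]
  rw [integral_cexp_quadratic (neg_one_div_re hP)]
  congr 1
  · rw [← ofReal_cpow_half (by positivity)]
    congr 1
    push_cast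
    field_simp
  · congr 1
    field_simp
    ring

theorem sqrt_two_pi_mul_ne_zero {P : ℝ} (hP : 0 < P) :
    (Real.sqrt (2 * Real.pi * P) : ℂ) ≠ 0 := by
  exact_mod_cast (Real.sqrt_pos.2 (by positivity)).ne'

theorem integral_norm_gaussKernel_mul_exp {P : ℝ} (hP : 0 < P) (x : ℂ) (c : ℝ) :
    ∫ t : ℝ, ‖gaussKernel P x t * Complex.exp (c * t)‖ =
      Real.exp (x.im ^ 2 / (2 * P)) * (Real.sqrt (2 * Real.pi * P) *
        Real.exp (c * x.re + P * (c * (c - 1) / 2))) := by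
  have h1 : ∀ t : ℝ, ((‖gaussKernel P x t * Complex.exp (c * t)‖ : ℝ) : ℂ) =
      (Real.exp (x.im ^ 2 / (2 * P)) : ℂ) *
        (gaussKernel P x.re t * Complex.exp (c * t)) := by
    intro t
    rw [norm_mul, norm_gaussKernel, Complex.norm_exp, gaussKernel]
    push_cast
    rw [← Complex.exp_add, ← Complex.exp_add, ← Complex.exp_add]
    congr 1
    simp
    ring
  have h2 : ((∫ t : ℝ, ‖gaussKernel P x t * Complex.exp (c * t)‖ : ℝ) : ℂ) =
      (Real.exp (x.im ^ 2 / (2 * P)) : ℂ) * ((Real.sqrt (2 * Real.pi * P) : ℂ) *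
        Complex.exp (c * x.re + P * (c * (c - 1) / 2))) := by
    rw [← integral_complex_ofReal]
    simp only [h1]
    rw [integral_const_mul, integral_gaussKernel_mul_exp hP]
  apply Complex.ofReal_injective
  rw [h2]
  push_cast
  rfl

/-! ### Holomorphy and growth of the `q`-Laplace transform -/

/-- The `q`-Laplace transform as a Mellin transform. -/
theorem gaussTransform_eq_mellin {P : ℝ} (hP : 0 < P) (φ : ℂ → ℂ) (x : ℂ) :
    gaussTransform P φ x = 1 / (Real.sqrt (2 * Real.pi * P) : ℂ) *
      (Complex.exp (-(x - P / 2) ^ 2 / (2 * P)) *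
        mellin (fun ξ : ℝ => (Real.exp (-(Real.log ξ) ^ 2 / (2 * P)) : ℂ) * φ (Real.log ξ))
          ((x - P / 2) / P)) := by
  have hP' : (P : ℂ) ≠ 0 := by exact_mod_cast hP.ne'
  rw [gaussTransform]
  congr 1
  -- Substitution `ξ = e^t`. Expanding the square in the kernel leaves a Gaussian in `x`, a Gaussian
  -- in `t` and the Mellin factor `e^{t(x - P/2)/P}`.
  rw [mellin, ← Real.range_exp, ← Set.image_univ, integral_image_eq_integral_abs_deriv_smul
    MeasurableSet.univ (fun t _ => (Real.hasDerivAt_exp t).hasDerivWithinAt)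
    Real.exp_injective.injOn, setIntegral_univ, ← integral_const_mul]
  congr 1
  funext t
  rw [Real.log_exp, abs_of_pos (Real.exp_pos t), Complex.real_smul, smul_eq_mul,
    Complex.cpow_def_of_ne_zero (by exact_mod_cast (Real.exp_pos t).ne'),
    ← Complex.ofReal_log (Real.exp_pos t).le, Real.log_exp, gaussKernel]
  push_cast
  have : ∀ a b c d e : ℂ, a * (b * (c * (d * e))) = (a * b * c * d) * e := by intros; ring
  rw [this, ← Complex.exp_add, ← Complex.exp_add, ← Complex.exp_add]
  congr 2
  field_simp
  ring

/-- The growth of `φ` cancels the quadratic part of the kernel at `+∞`, leaving a linear exponential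
that converges only for `re x < P/2 - a`. Holomorphy is inherited from the Mellin transform. -/
theorem gaussTransform_differentiableAt {P : ℝ} (hP : 0 < P) {φ : ℂ → ℂ} {a C : ℝ}
    (hc : Continuous fun t : ℝ => φ t) (hbot : ∀ᶠ t : ℝ in atBot, ‖φ t‖ ≤ C)
    (htop : ∀ᶠ t : ℝ in atTop, ‖φ t‖ ≤ C * Real.exp ((a + t) ^ 2 / (2 * P)))
    {x : ℂ} (hx : x.re - P / 2 + a < 0) :
    DifferentiableAt ℂ (gaussTransform P φ) x := by
  have hs : ((x - P / 2) / P : ℂ).re = (x.re - P / 2) / P := by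
    rw [Complex.div_ofReal_re]
    simp
  have key : DifferentiableAt ℂ
      (mellin (fun ξ : ℝ => (Real.exp (-(Real.log ξ) ^ 2 / (2 * P)) : ℂ) * φ (Real.log ξ)))
      ((x - P / 2) / P) := by
    -- At infinity Gaussian times growth is a constant multiple of `ξ^{a/P}`. At `0` the Gaussian in
    -- `log ξ` beats every power, so any exponent below the real part of the argument serves.
    refine mellin_differentiableAt_of_isBigO_rpow (a := -a / P) (b := (x.re - P / 2) / P - 1)
      ?_ ?_ ?_ ?_ ?_
    · refine ContinuousOn.locallyIntegrableOn ?_ measurableSet_Ioi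
      have hlog : ContinuousOn Real.log (Set.Ioi 0) :=
        Real.continuousOn_log.mono fun y hy => (ne_of_gt hy : y ≠ 0)
      exact ContinuousOn.mul (by fun_prop) (hc.comp_continuousOn hlog)
    · refine Asymptotics.IsBigO.of_bound (C * Real.exp (a ^ 2 / (2 * P))) ?_
      filter_upwards [Real.tendsto_log_atTop.eventually htop, eventually_gt_atTop 0] with ξ h1 h0
      rw [norm_mul, Complex.norm_real, Real.norm_of_nonneg (Real.exp_pos _).le,
        Real.norm_of_nonneg (Real.rpow_nonneg h0.le _), Real.rpow_def_of_pos h0]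
      refine (mul_le_mul_of_nonneg_left h1 (Real.exp_pos _).le).trans (le_of_eq ?_)
      rw [mul_left_comm, mul_assoc, ← Real.exp_add, ← Real.exp_add]
      congr 2
      field_simp
      ring
    · rw [hs, div_lt_div_iff_of_pos_right hP]
      linarith
    · set β : ℝ := -((x.re - P / 2) / P - 1)
      refine Asymptotics.IsBigO.of_bound (C * Real.exp (P * β ^ 2 / 2)) ?_
      filter_upwards [Real.tendsto_log_nhdsGT_zero.eventually hbot, self_mem_nhdsWithin]
        with ξ h1 h0
      have h0 : 0 < ξ := h0
      have hC : 0 ≤ C := (norm_nonneg _).trans h1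
      rw [norm_mul, Complex.norm_real, Real.norm_of_nonneg (Real.exp_pos _).le,
        Real.norm_of_nonneg (Real.rpow_nonneg h0.le _), Real.rpow_def_of_pos h0]
      refine (mul_le_mul_of_nonneg_left h1 (Real.exp_pos _).le).trans ?_
      rw [mul_comm, mul_assoc, ← Real.exp_add]
      refine mul_le_mul_of_nonneg_left (Real.exp_le_exp.2 ?_) hC
      have : P * β ^ 2 / 2 + Real.log ξ * β - -Real.log ξ ^ 2 / (2 * P) =
          (P * β + Real.log ξ) ^ 2 / (2 * P) := by
        field_simp
        ring
      have h2 : 0 ≤ (P * β + Real.log ξ) ^ 2 / (2 * P) := by positivity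
      linarith
    · rw [hs]
      linarith
  have e : gaussTransform P φ = fun x => 1 / (Real.sqrt (2 * Real.pi * P) : ℂ) *
      (Complex.exp (-(x - P / 2) ^ 2 / (2 * P)) *
        mellin (fun ξ : ℝ => (Real.exp (-(Real.log ξ) ^ 2 / (2 * P)) : ℂ) * φ (Real.log ξ))
          ((x - P / 2) / P)) := funext fun x => gaussTransform_eq_mellin hP φ x
  rw [e]
  refine DifferentiableAt.const_mul (DifferentiableAt.mul (by fun_prop) ?_) _
  exact DifferentiableAt.comp (g := mellin _) (f := fun x : ℂ => (x - P / 2) / P) x key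
    (by fun_prop)

theorem gaussTransform_differentiable {P : ℝ} (hP : 0 < P) {φ : ℂ → ℂ} {C : ℝ}
    (hc : Continuous fun t : ℝ => φ t) (hb : ∀ t : ℝ, ‖φ t‖ ≤ C) :
    Differentiable ℂ (gaussTransform P φ) := by
  intro x
  have hC : 0 ≤ C := (norm_nonneg _).trans (hb 0)
  -- A bounded function satisfies the growth condition for every `a`; this choice puts `x` inside
  -- the half-plane of convergence.
  refine gaussTransform_differentiableAt hP (a := -x.re) (C := C) hc (Eventually.of_forall hb)
    (Eventually.of_forall fun t => (hb t).trans ?_) (by linarith)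
  exact le_mul_of_one_le_right hC (Real.one_le_exp (by positivity))

theorem norm_gaussTransform_le {P : ℝ} (hP : 0 < P) {φ : ℂ → ℂ} {C : ℝ}
    (hb : ∀ t : ℝ, ‖φ t‖ ≤ C) (x : ℂ) :
    ‖gaussTransform P φ x‖ ≤ C * Real.exp (x.im ^ 2 / (2 * P)) := by
  have hs := Real.sqrt_pos.2 (show 0 < 2 * Real.pi * P by positivity)
  have h1 := integral_norm_gaussKernel_mul_exp hP x 0
  simp only [Complex.ofReal_zero, zero_mul, Complex.exp_zero, mul_one, zero_div, mul_zero,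
    add_zero, Real.exp_zero] at h1
  have h2 : ‖∫ t : ℝ, gaussKernel P x t * φ t‖ ≤ ∫ t : ℝ, ‖gaussKernel P x t‖ * C := by
    refine norm_integral_le_of_norm_le ((integrable_gaussKernel hP x).norm.mul_const C)
      (Eventually.of_forall fun t => ?_)
    rw [norm_mul]
    exact mul_le_mul_of_nonneg_left (hb t) (norm_nonneg _)
  rw [integral_mul_const, h1] at h2
  rw [gaussTransform, norm_mul, norm_div, norm_one, Complex.norm_real,
    Real.norm_of_nonneg hs.le, one_div]
  refine (mul_le_mul_of_nonneg_left h2 (inv_nonneg.2 hs.le)).trans (le_of_eq ?_)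
  field_simp

/-! ### Continuity of `q`-multisums near `0` -/

theorem ofReal_mem_sector {ε : ℝ} (hε : 0 < ε) (t : ℝ) : (t : ℂ) ∈ sector 0 ε := by
  simpa [sector, argument] using hε

theorem continuous_of_differentiableOn_sector {ε : ℝ} (hε : 0 < ε) {φ : ℂ → ℂ}
    (h : DifferentiableOn ℂ φ (sector 0 ε)) : Continuous fun t : ℝ => φ t :=
  h.continuousOn.comp_continuous Complex.continuous_ofReal fun t => ofReal_mem_sector hε t

/-- The growth on the half-line of the elements of `𝔼_{q;k}^0`. -/
theorem MemE.exists_bound {q k : ℝ} (hq : 1 < q) {φ : LogSurface → ℂ} (h : MemE q k 0 φ) :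
    ∃ a C : ℝ, (∀ᶠ t : ℝ in atBot, ‖φ t‖ ≤ C) ∧
      ∀ᶠ t : ℝ in atTop, ‖φ t‖ ≤ C * Real.exp ((a + t) ^ 2 / (2 * (Real.log q / k))) := by
  obtain ⟨ε, hε, -, A, hA, R, hR, C, h1, h2⟩ := h
  refine ⟨Real.log A, C, ?_, ?_⟩
  · filter_upwards [eventually_le_atBot (Real.log R)] with t ht
    exact h1 t (ofReal_mem_sector hε t) (by simpa [modulus] using (Real.le_log_iff_exp_le hR).1 ht)
  · filter_upwards [eventually_gt_atTop (Real.log R)] with t ht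
    have h3 := h2 t (ofReal_mem_sector hε t)
      (by simpa [modulus] using (Real.log_lt_iff_lt_exp hR).1 ht)
    rw [log_base (by linarith), modulus, Complex.ofReal_re,
      Real.log_mul hA.ne' (Real.exp_pos _).ne', Real.log_exp] at h3
    rw [neg_div, Real.exp_neg, ← div_eq_mul_inv, div_le_iff₀ (Real.exp_pos _)] at h3
    exact h3

theorem MemE.continuousOn_laplace {q k : ℝ} (hq : 1 < q) (hk : 0 < k) {φ : LogSurface → ℂ}
    (h : MemE q k 0 φ) : ∃ R : ℝ, 0 < R ∧ ContinuousOn (laplace q k 0 φ) (disc R) := by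
  obtain ⟨a, C, hbot, htop⟩ := h.exists_bound hq
  obtain ⟨ε, hε, hd, -⟩ := h
  have hP : 0 < Real.log q / k := div_pos (Real.log_pos hq) hk
  refine ⟨Real.exp (Real.log q / k / 2 - a), Real.exp_pos _, fun x hx => ?_⟩
  rw [laplace_zero (by linarith)]
  have hx : x.re < Real.log q / k / 2 - a := Real.exp_lt_exp.1 hx
  exact (gaussTransform_differentiableAt hP (continuous_of_differentiableOn_sector hε hd)
    hbot htop (by linarith)).continuousAt.continuousWithinAt

/-- Only the last transform matters: it is applied to an element of the space of its own order,
whatever the earlier stages were. -/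
theorem IsIteratedLaplace.continuousOn {q : ℝ} (hq : 1 < q) : ∀ (l : List ℚ) (s : ℚ)
    {g F : LogSurface → ℂ}, (∀ a ∈ s :: l, 0 < a) → IsIteratedLaplace q 0 (tilde (s :: l)) g F →
      ∃ R : ℝ, 0 < R ∧ ContinuousOn F (disc R)
  | [], s, g, F, hs, ⟨φ, hm, _, h⟩ => by
    rw [show F = _ from h]
    exact hm.continuousOn_laplace hq (by exact_mod_cast hs s (by simp))
  | s' :: l, s, g, F, hs, ⟨φ, _, _, h⟩ =>
    IsIteratedLaplace.continuousOn hq l s' (fun a ha => hs a (List.mem_cons_of_mem _ ha)) h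

theorem IsConvergent.continuousOn_seriesSum {f : PowerSeries ℂ} (hf : IsConvergent f) :
    ∃ R : ℝ, 0 < R ∧ ContinuousOn (seriesSum f) (disc R) := by
  obtain ⟨r, hr, h⟩ := hf
  refine ⟨r / 2, by positivity, ?_⟩
  have h1 := (h ((r / 2 : ℝ) : ℂ) (by
    rw [Complex.norm_real, Real.norm_of_nonneg (by positivity)]; linarith)).norm
  refine continuousOn_tsum (fun n => by unfold proj; fun_prop) h1 fun n x hx => ?_
  rw [norm_mul, norm_mul, norm_pow, norm_pow, proj, Complex.norm_exp, Complex.norm_real,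
    Real.norm_of_nonneg (by positivity : 0 ≤ r / 2)]
  have hx : Real.exp x.re < r / 2 := hx
  gcongr

/-- `q`-multisums are continuous near `0`. -/
theorem IsQMultisum.continuousOn {q : ℝ} (hq : 1 < q) {s : List ℚ} (hs : IsOrder s)
    {f : PowerSeries ℂ} {F : LogSurface → ℂ} (h : IsQMultisum q 0 s f F) :
    ∃ R : ℝ, 0 < R ∧ ContinuousOn F (disc R) := by
  cases s with
  | nil => exact h.2 ▸ h.1.continuousOn_seriesSum
  | cons s l => exact IsIteratedLaplace.continuousOn hq l s hs.2 h.2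

/-! ### The `q`-sum of the `q`-Euler series -/

/-- The `q`-Borel transform `1 / (1 + ξ)` of the `q`-Euler series, in logarithmic coordinates. -/
noncomputable def logistic (x : ℂ) : ℂ := (1 + Complex.exp x)⁻¹

/-- Since `1 < π/2`, the real part of `e^x` is positive on this sector. -/
theorem one_le_norm_one_add_exp {x : ℂ} (hx : x ∈ sector 0 1) : 1 ≤ ‖1 + Complex.exp x‖ := by
  have h1 : |x.im| < 1 := by simpa [sector, argument] using hx
  have h2 : 0 < Real.cos x.im := by
    have := Real.pi_gt_three
    rw [abs_lt] at h1
    exact Real.cos_pos_of_mem_Ioo ⟨by linarith, by linarith⟩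
  refine le_trans ?_ (Complex.re_le_norm _)
  rw [Complex.add_re, Complex.one_re, Complex.exp_re]
  have := mul_pos (Real.exp_pos x.re) h2
  linarith

theorem norm_logistic_le {x : ℂ} (hx : x ∈ sector 0 1) : ‖logistic x‖ ≤ 1 := by
  rw [logistic, norm_inv]
  exact inv_le_one_of_one_le₀ (one_le_norm_one_add_exp hx)

theorem norm_logistic_ofReal_le (t : ℝ) : ‖logistic t‖ ≤ 1 :=
  norm_logistic_le (ofReal_mem_sector one_pos t)

theorem differentiableOn_logistic : DifferentiableOn ℂ logistic (sector 0 1) := by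
  intro x hx
  have : 1 + Complex.exp x ≠ 0 := by
    intro h
    have := one_le_norm_one_add_exp hx
    rw [h, norm_zero] at this
    linarith
  have h : DifferentiableAt ℂ (fun y => 1 + Complex.exp y) x := by fun_prop
  exact (h.inv this).differentiableWithinAt

theorem continuous_logistic_ofReal : Continuous fun t : ℝ => logistic t :=
  continuous_of_differentiableOn_sector one_pos differentiableOn_logistic

theorem logistic_sub_two_pi_I (t : ℂ) : logistic (t - 2 * Real.pi * Complex.I) = logistic t := by
  rw [logistic, logistic, Complex.exp_sub, Complex.exp_two_pi_mul_I, div_one]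

/-- Controls the integrand on the vertical sides of the contour, where the imaginary part is not
confined to a small sector. -/
theorem norm_logistic_le_two {x : ℂ} (hx : 1 ≤ |x.re|) : ‖logistic x‖ ≤ 2 := by
  have h : 1 / 2 ≤ ‖1 + Complex.exp x‖ := by
    have h1 := abs_norm_sub_norm_le (-1 : ℂ) (Complex.exp x)
    rw [norm_neg, norm_one, Complex.norm_exp, ← norm_neg (-1 - Complex.exp x)] at h1
    have e : -(-1 - Complex.exp x) = 1 + Complex.exp x := by ring
    rw [e] at h1
    refine le_trans ?_ h1
    rcases le_abs.1 hx with h2 | h2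
    · have := Real.add_one_le_exp x.re
      rw [le_abs]; right; linarith
    · have h3 := Real.add_one_le_exp (-x.re)
      rw [Real.exp_neg] at h3
      have h4 : Real.exp x.re ≤ 1 / 2 := by
        rw [← one_div, le_div_iff₀ (Real.exp_pos _)] at h3
        have := Real.exp_pos x.re
        nlinarith
      rw [le_abs]; left; linarith
  rw [logistic, norm_inv]
  exact inv_le_of_inv_le₀ (by norm_num) (by simpa using h)

/-- The `q`-sum of the `q`-Euler series for `log q = P`. -/
noncomputable def eulerSum (P : ℝ) : ℂ → ℂ := gaussTransform P logistic

theorem differentiable_eulerSum {P : ℝ} (hP : 0 < P) : Differentiable ℂ (eulerSum P) :=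
  gaussTransform_differentiable hP continuous_logistic_ofReal norm_logistic_ofReal_le

theorem norm_eulerSum_le {P : ℝ} (hP : 0 < P) (x : ℂ) :
    ‖eulerSum P x‖ ≤ Real.exp (x.im ^ 2 / (2 * P)) := by
  simpa only [one_mul] using! norm_gaussTransform_le hP norm_logistic_ofReal_le x

theorem integrable_gaussKernel_mul_of_bounded {P : ℝ} (hP : 0 < P) {φ : ℂ → ℂ} {C : ℝ}
    (hc : Continuous fun t : ℝ => φ t) (hb : ∀ t : ℝ, ‖φ t‖ ≤ C) (x : ℂ) :
    Integrable fun t : ℝ => gaussKernel P x t * φ t := by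
  have := (integrable_gaussKernel hP x).bdd_mul hc.aestronglyMeasurable (Eventually.of_forall hb)
  simpa only [mul_comm] using this

theorem integrable_gaussKernel_mul_logistic {P : ℝ} (hP : 0 < P) (x : ℂ) :
    Integrable fun t : ℝ => gaussKernel P x t * logistic t :=
  integrable_gaussKernel_mul_of_bounded hP continuous_logistic_ofReal norm_logistic_ofReal_le x

/-- The `q`-difference equation `x σ_q y + y = 1`. -/
theorem eulerSum_functional_equation {P : ℝ} (hP : 0 < P) (x : ℂ) :
    Complex.exp x * eulerSum P (x + P) + eulerSum P x = 1 := by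
  have hP' : (P : ℂ) ≠ 0 := by exact_mod_cast hP.ne'
  have hk : ∀ t : ℝ, Complex.exp x * (gaussKernel P (x + P) t * logistic t) +
      gaussKernel P x t * logistic t = gaussKernel P x t * Complex.exp (0 * t) := by
    intro t
    have h1 : Complex.exp x * gaussKernel P (x + P) t =
        gaussKernel P x t * Complex.exp t := by
      rw [gaussKernel, gaussKernel, ← Complex.exp_add, ← Complex.exp_add]
      congr 1
      field_simp
      ring
    have h2 : 1 + Complex.exp t ≠ 0 := by
      intro h
      have := one_le_norm_one_add_exp (ofReal_mem_sector one_pos t)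
      rw [h, norm_zero] at this
      linarith
    rw [← mul_assoc, h1, logistic, zero_mul, Complex.exp_zero]
    field_simp
    ring
  rw [eulerSum, gaussTransform, gaussTransform, mul_left_comm, ← mul_add, ← integral_const_mul,
    ← integral_add ((integrable_gaussKernel_mul_logistic hP _).const_mul _)
      (integrable_gaussKernel_mul_logistic hP _)]
  simp only [hk]
  rw [integral_gaussKernel_mul_exp hP]
  simp [sqrt_two_pi_mul_ne_zero hP]

/-- The functional equation gives `-e^x` times the value at `x + P`, and the a priori bound depends
only on the imaginary part, which this translation preserves. -/
theorem norm_eulerSum_sub_one_le {P : ℝ} (hP : 0 < P) (x : ℂ) :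
    ‖eulerSum P x - 1‖ ≤ Real.exp x.re * Real.exp (x.im ^ 2 / (2 * P)) := by
  have h : eulerSum P x - 1 = -(Complex.exp x * eulerSum P (x + P)) := by
    rw [← eulerSum_functional_equation hP x]; ring
  rw [h, norm_neg, norm_mul, Complex.norm_exp]
  have := norm_eulerSum_le hP (x + P)
  rw [Complex.add_im, Complex.ofReal_im, add_zero] at this
  gcongr

/-! ### The Stokes jump: moving the contour across the pole -/

/-- Integrability over `ℝ` and integral of `1 / (t - πi) - 1 / (t + πi)`. -/
theorem integrable_inv_sub_inv_and_integral :
    (Integrable fun t : ℝ => ((t : ℂ) - Real.pi * Complex.I)⁻¹ - (t + Real.pi * Complex.I)⁻¹) ∧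
    ∫ t : ℝ, (((t : ℂ) - Real.pi * Complex.I)⁻¹ - (t + Real.pi * Complex.I)⁻¹) =
      2 * Real.pi * Complex.I := by
  have hpi : (Real.pi : ℂ) ≠ 0 := by exact_mod_cast Real.pi_ne_zero
  have e : ∀ t : ℝ, ((t : ℂ) - Real.pi * Complex.I)⁻¹ - (t + Real.pi * Complex.I)⁻¹ =
      (2 * Complex.I / Real.pi) * (((1 + (t / Real.pi) ^ 2)⁻¹ : ℝ) : ℂ) := by
    intro t
    have hI := Complex.I_sq
    have h1 : (t : ℂ) - Real.pi * Complex.I ≠ 0 := fun h => by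
      have := congrArg Complex.im h
      simp [Real.pi_ne_zero] at this
    have h2 : (t : ℂ) + Real.pi * Complex.I ≠ 0 := fun h => by
      have := congrArg Complex.im h
      simp [Real.pi_ne_zero] at this
    have h3 : (1 + (t / Real.pi : ℂ) ^ 2) =
        ((t : ℂ) - Real.pi * Complex.I) * (t + Real.pi * Complex.I) / Real.pi ^ 2 := by
      field_simp
      linear_combination (Real.pi : ℂ) ^ 2 * hI
    push_cast
    rw [h3]
    field_simp
    ring
  simp only [e]
  constructor
  · exact ((integrable_inv_one_add_sq.comp_div Real.pi_ne_zero).ofReal).const_mul _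
  · rw [integral_const_mul, integral_complex_ofReal,
      Measure.integral_comp_div (fun t : ℝ => (1 + t ^ 2)⁻¹) Real.pi,
      integral_univ_inv_one_add_sq, abs_of_pos Real.pi_pos]
    rw [smul_eq_mul]
    push_cast
    field_simp

/-- The open strip around the pole `-πi` of `1 / (1 + e^t)`. -/
def poleStrip : Set ℂ := {t | -(3 * Real.pi) < t.im ∧ t.im < Real.pi}

theorem isOpen_poleStrip : IsOpen poleStrip :=
  (isOpen_lt continuous_const Complex.continuous_im).inter
    (isOpen_lt Complex.continuous_im continuous_const)

theorem neg_pi_I_mem_poleStrip : -(Real.pi * Complex.I) ∈ poleStrip := by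
  have := Real.pi_pos
  constructor <;> simp <;> linarith

theorem exp_neg_pi_I : Complex.exp (-(Real.pi * Complex.I)) = -1 := by
  rw [Complex.exp_neg, Complex.exp_pi_mul_I]; norm_num

theorem one_add_exp_ne_zero_of_mem_poleStrip {t : ℂ} (ht : t ∈ poleStrip)
    (h : t ≠ -(Real.pi * Complex.I)) : 1 + Complex.exp t ≠ 0 := by
  intro h0
  have h1 : Complex.exp t = Complex.exp (-(Real.pi * Complex.I)) := by
    rw [exp_neg_pi_I]; linear_combination h0
  obtain ⟨n, hn⟩ := Complex.exp_eq_exp_iff_exists_int.1 h1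
  have him : t.im = -Real.pi + n * (2 * Real.pi) := by
    rw [hn]; simp
  have hpi := Real.pi_pos
  obtain ⟨h2, h3⟩ := ht
  rw [him] at h2 h3
  have h4 : (n : ℝ) < 1 := by nlinarith
  have h5 : (-1 : ℝ) < n := by nlinarith
  have h6 : n < 1 := by exact_mod_cast h4
  have h7 : -1 < n := by exact_mod_cast h5
  have h8 : n = 0 := by omega
  apply h
  rw [hn, h8]
  simp

/-- Subtracting the polar part at `-πi` from a function divided by `1 + e^t`. -/
theorem exists_regular_part {N : ℂ → ℂ} (hN : Differentiable ℂ N) :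
    ∃ Φ : ℂ → ℂ, DifferentiableOn ℂ Φ poleStrip ∧
      ∀ t ∈ poleStrip, t ≠ -(Real.pi * Complex.I) →
        Φ t = N t * logistic t + N (-(Real.pi * Complex.I)) * (t + Real.pi * Complex.I)⁻¹ := by
  set t₀ : ℂ := -(Real.pi * Complex.I) with ht₀
  -- Here `1 + e^t = (t - t₀) E(t)` with `E` zero-free on the strip and `E(t₀) = e^{t₀} = -1`. The
  -- divided difference of `N / E` at `t₀` is then the quotient minus its polar part, of residue
  -- `-N(t₀)`.
  set E : ℂ → ℂ := dslope (fun t => 1 + Complex.exp t) t₀ with hE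
  have hnhds : poleStrip ∈ 𝓝 t₀ := isOpen_poleStrip.mem_nhds neg_pi_I_mem_poleStrip
  have hE1 : ∀ t, t ≠ t₀ → E t = (1 + Complex.exp t) / (t - t₀) := by
    intro t ht
    rw [hE, dslope_of_ne _ ht, slope_def_field, exp_neg_pi_I]
    simp
  have hE0 : E t₀ = -1 := by
    rw [hE, dslope_same]
    simp [ht₀]
  have hEne : ∀ t ∈ poleStrip, E t ≠ 0 := by
    intro t ht
    by_cases h : t = t₀
    · rw [h, hE0]; norm_num
    · rw [hE1 t h]
      exact div_ne_zero (one_add_exp_ne_zero_of_mem_poleStrip ht h) (sub_ne_zero.2 h)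
  have hEd : DifferentiableOn ℂ E poleStrip :=
    (Complex.differentiableOn_dslope hnhds).2 (by fun_prop)
  have hψ : DifferentiableOn ℂ (fun t => N t / E t) poleStrip :=
    hN.differentiableOn.div hEd hEne
  refine ⟨dslope (fun t => N t / E t) t₀, (Complex.differentiableOn_dslope hnhds).2 hψ, ?_⟩
  intro t ht h
  have h1 : t - t₀ ≠ 0 := sub_ne_zero.2 h
  have h2 := one_add_exp_ne_zero_of_mem_poleStrip ht h
  have h3 : t + Real.pi * Complex.I = t - t₀ := by rw [ht₀]; ring
  rw [dslope_of_ne _ h, slope_def_field, hE0, hE1 t h, h3, logistic]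
  field_simp
  ring

theorem norm_gaussKernel_add_mul_I_le (P : ℝ) (hP : 0 < P) (x : ℂ) (T : ℝ) {y M : ℝ}
    (hy : |y| ≤ M) : ‖gaussKernel P x (T + y * Complex.I)‖ ≤
      Real.exp (((|x.im| + M) ^ 2 - (x.re - P / 2 - T) ^ 2) / (2 * P)) := by
  have h : gaussKernel P x (T + y * Complex.I) = gaussKernel P (x - y * Complex.I) T := by
    unfold gaussKernel
    congr 3
    ring
  rw [h, norm_gaussKernel]
  have h1 : (x - y * Complex.I).im = x.im - y := by simp
  have h2 : (x - y * Complex.I).re = x.re := by simp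
  rw [h1, h2]
  have h3 : (x.im - y) ^ 2 ≤ (|x.im| + M) ^ 2 := by
    apply sq_le_sq'
    · linarith [neg_abs_le x.im, le_abs_self y]
    · linarith [le_abs_self x.im, neg_abs_le y]
  gcongr

theorem differentiable_gaussKernel (P : ℝ) (x : ℂ) : Differentiable ℂ (gaussKernel P x) := by
  unfold gaussKernel
  fun_prop

theorem tendsto_gaussian_bound {P : ℝ} (hP : 0 < P) (M m r : ℝ) {l : Filter ℝ}
    (hl : Tendsto (fun T : ℝ => |T|) l atTop) :
    Tendsto (fun T : ℝ => Real.exp ((M - (m - T) ^ 2) / (2 * P)) * 2 + r * |T|⁻¹) l (𝓝 0) := by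
  have h1 : Tendsto (fun T : ℝ => (M - (m - T) ^ 2) / (2 * P)) l atBot := by
    refine Tendsto.atBot_div_const (by positivity) ?_
    refine tendsto_atBot_mono' l (f₁ := fun T => M + |m| - |T|) ?_ ?_
    · filter_upwards [hl.eventually_ge_atTop (|m| + 1)] with T hT
      have h2 : |T| - |m| ≤ |m - T| := by
        have := abs_sub_abs_le_abs_sub T m
        rwa [abs_sub_comm] at this
      have h3 : |m - T| ^ 2 = (m - T) ^ 2 := sq_abs _
      nlinarith
    · exact tendsto_atBot_add_const_left _ _ (tendsto_neg_atTop_atBot.comp hl)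
  have h2 := (Real.tendsto_exp_atBot.comp h1).mul_const 2
  have h3 := (tendsto_inv_atTop_zero.comp hl).const_mul r
  simpa using h2.add h3

/-- The constant in the Stokes phenomenon. -/
noncomputable def stokesConst (P : ℝ) : ℂ :=
  -(2 * Real.pi * Complex.I) / (Real.sqrt (2 * Real.pi * P) : ℂ)

/-- The difference of two determinations of the `q`-sum of the `q`-Euler series. -/
noncomputable def stokesJump (P : ℝ) (x : ℂ) : ℂ :=
  stokesConst P * Complex.exp (-(x - P / 2 + Real.pi * Complex.I) ^ 2 / (2 * P))

/-- The logistic factor is `2πi`-periodic, so translating `x` by `2πi` amounts to lowering the line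
of integration by `2π`, past the pole `-πi`. Cauchy's theorem is applied to the integrand without
its polar part; the polar part is integrated explicitly. -/
theorem integral_shifted_sub {P : ℝ} (hP : 0 < P) (x : ℂ) :
    (∫ t : ℝ, gaussKernel P (x + 2 * Real.pi * Complex.I) t * logistic t) -
      ∫ t : ℝ, gaussKernel P x t * logistic t =
    -(2 * Real.pi * Complex.I) * gaussKernel P x (-(Real.pi * Complex.I)) := by
  have hpi := Real.pi_pos
  obtain ⟨Φ, hΦd, hΦ⟩ := exists_regular_part (differentiable_gaussKernel P x)
  set r : ℂ := gaussKernel P x (-(Real.pi * Complex.I)) with hr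
  have hmem : ∀ t y : ℝ, y ∈ Set.Icc (-(2 * Real.pi)) 0 →
      (t : ℂ) + y * Complex.I ∈ poleStrip := by
    intro t y hy
    constructor <;> simp <;> linarith [hy.1, hy.2]
  have hcont : ∀ y : ℝ, y ∈ Set.Icc (-(2 * Real.pi)) 0 →
      Continuous fun t : ℝ => Φ ((t : ℂ) + y * Complex.I) := fun y hy =>
    hΦd.continuousOn.comp_continuous (by fun_prop) fun t => hmem t y hy
  have hΦ' : ∀ t y : ℝ, y ∈ Set.Icc (-(2 * Real.pi)) 0 → (t ≠ 0 ∨ y ≠ -Real.pi) →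
      Φ ((t : ℂ) + y * Complex.I) = gaussKernel P x ((t : ℂ) + y * Complex.I) *
        logistic ((t : ℂ) + y * Complex.I) + r * ((t : ℂ) + y * Complex.I +
          Real.pi * Complex.I)⁻¹ := by
    intro t y hy h
    refine hΦ _ (hmem t y hy) fun h0 => ?_
    have h1 := congrArg Complex.re h0
    have h2 := congrArg Complex.im h0
    simp at h1 h2
    tauto
  have m1 : -(2 * Real.pi) ∈ Set.Icc (-(2 * Real.pi)) 0 := ⟨le_rfl, by linarith⟩
  have m2 : (0 : ℝ) ∈ Set.Icc (-(2 * Real.pi)) 0 := ⟨by linarith, le_rfl⟩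
  have hD : ∀ t : ℝ, Φ ((t : ℂ) + (-(2 * Real.pi) : ℝ) * Complex.I) -
      Φ ((t : ℂ) + (0 : ℝ) * Complex.I) =
      gaussKernel P (x + 2 * Real.pi * Complex.I) t * logistic t - gaussKernel P x t * logistic t +
        r * (((t : ℂ) - Real.pi * Complex.I)⁻¹ - (t + Real.pi * Complex.I)⁻¹) := by
    intro t
    rw [hΦ' t _ m1 (Or.inr (by linarith)), hΦ' t 0 m2 (Or.inr (by linarith))]
    have e1 : (t : ℂ) + ((-(2 * Real.pi) : ℝ) : ℂ) * Complex.I =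
        t - 2 * Real.pi * Complex.I := by push_cast; ring
    have e2 : gaussKernel P x (t - 2 * Real.pi * Complex.I) =
        gaussKernel P (x + 2 * Real.pi * Complex.I) t := by
      unfold gaussKernel
      congr 3
      ring
    have e3 : (t : ℂ) - 2 * Real.pi * Complex.I + Real.pi * Complex.I =
        t - Real.pi * Complex.I := by ring
    rw [e1, logistic_sub_two_pi_I, e2, e3, Complex.ofReal_zero, zero_mul, add_zero]
    ring
  have i1 := integrable_gaussKernel_mul_logistic hP (x + 2 * Real.pi * Complex.I)
  have i2 := integrable_gaussKernel_mul_logistic hP x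
  obtain ⟨i3, v3⟩ := integrable_inv_sub_inv_and_integral
  have lim1 := intervalIntegral_tendsto_integral
    (((i1.sub i2).add (i3.const_mul r))) tendsto_neg_atTop_atBot tendsto_id
  -- The vertical sides vanish in the limit: Gaussian decay of the kernel for one term, `1/|T|`
  -- decay for the polar part.
  have vert : ∀ (u : ℝ → ℝ), Tendsto (fun T => |u T|) atTop atTop →
      Tendsto (fun T : ℝ => Complex.I •
        ∫ y in (-(2 * Real.pi))..0, Φ ((u T : ℂ) + y * Complex.I)) atTop (𝓝 0) := by
    intro u hu
    set B : ℝ → ℝ := fun T => Real.exp (((|x.im| + 2 * Real.pi) ^ 2 -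
      ((x.re - P / 2) - T) ^ 2) / (2 * P)) * 2 + ‖r‖ * |T|⁻¹ with hB
    have hBlim : Tendsto (fun T => B (u T) * |0 - -(2 * Real.pi)|) atTop (𝓝 0) := by
      have h1 : Tendsto (fun T : ℝ => |T|) (map u atTop) atTop := hu
      have := (tendsto_gaussian_bound hP ((|x.im| + 2 * Real.pi) ^ 2) (x.re - P / 2) ‖r‖ h1)
      simpa using (tendsto_map'_iff.1 this).mul_const |0 - -(2 * Real.pi)|
    refine squeeze_zero_norm' ?_ hBlim
    filter_upwards [hu.eventually_ge_atTop 1] with T hT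
    rw [norm_smul, Complex.norm_I, one_mul]
    refine intervalIntegral.norm_integral_le_of_norm_le_const fun y hy => ?_
    rw [Set.uIoc_of_le (by linarith)] at hy
    have hy' : y ∈ Set.Icc (-(2 * Real.pi)) 0 := ⟨hy.1.le, hy.2⟩
    have hu0 : u T ≠ 0 := by
      intro h; rw [h, abs_zero] at hT; linarith
    rw [hΦ' _ _ hy' (Or.inl hu0)]
    refine (norm_add_le _ _).trans (add_le_add ?_ ?_)
    · rw [norm_mul]
      refine mul_le_mul (norm_gaussKernel_add_mul_I_le P hP x _ ?_)
        (norm_logistic_le_two (by simpa using hT)) (norm_nonneg _) (Real.exp_pos _).le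
      rw [abs_le]; constructor <;> linarith [hy'.1, hy'.2]
    · rw [norm_mul, norm_inv]
      refine mul_le_mul_of_nonneg_left ?_ (norm_nonneg _)
      refine inv_anti₀ (by linarith) ?_
      refine le_trans (le_of_eq ?_) (Complex.abs_re_le_norm _)
      simp
  have v1 := vert (fun T => T) tendsto_abs_atTop_atTop
  have v2 := vert (fun T => -T) (by simpa using tendsto_abs_atTop_atTop)
  have rect : ∀ T : ℝ, (∫ t in (-T)..T,
      (gaussKernel P (x + 2 * Real.pi * Complex.I) t * logistic t - gaussKernel P x t * logistic t +
        r * (((t : ℂ) - Real.pi * Complex.I)⁻¹ - (t + Real.pi * Complex.I)⁻¹))) =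
      (Complex.I • ∫ y in (-(2 * Real.pi))..0, Φ (((-T : ℝ) : ℂ) + y * Complex.I)) -
      (Complex.I • ∫ y in (-(2 * Real.pi))..0, Φ ((T : ℂ) + y * Complex.I)) := by
    intro T
    have h := Complex.integral_boundary_rect_eq_zero_of_differentiableOn Φ
      ⟨-T, -(2 * Real.pi)⟩ ⟨T, 0⟩ (hΦd.mono ?_)
    · simp only [← hD]
      rw [intervalIntegral.integral_sub ((hcont _ m1).intervalIntegrable _ _)
        ((hcont _ m2).intervalIntegrable _ _)]
      simp only at h
      linear_combination h
    · intro t ht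
      have h1 := ht.2
      simp only [Set.mem_preimage] at h1
      rw [Set.uIcc_of_le (by linarith)] at h1
      have := hmem t.re t.im h1
      rwa [Complex.re_add_im] at this
  have lim2 : Tendsto (fun T : ℝ => ∫ t in (-T)..T,
      (gaussKernel P (x + 2 * Real.pi * Complex.I) t * logistic t - gaussKernel P x t * logistic t +
        r * (((t : ℂ) - Real.pi * Complex.I)⁻¹ - (t + Real.pi * Complex.I)⁻¹))) atTop (𝓝 0) := by
    simp only [rect]
    simpa using v2.sub v1
  -- The limit is the sought difference plus `r` times `2πi`, and it equals `0`.
  have h := tendsto_nhds_unique lim1 lim2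
  simp only [Pi.add_apply, Pi.sub_apply] at h
  have h1 := integral_add (i1.sub i2) (i3.const_mul r)
  simp only [Pi.sub_apply] at h1
  rw [h1, integral_const_mul, v3, integral_sub i1 i2] at h
  linear_combination h

theorem eulerSum_add_two_pi_I {P : ℝ} (hP : 0 < P) (x : ℂ) :
    eulerSum P (x + 2 * Real.pi * Complex.I) = eulerSum P x + stokesJump P x := by
  have h := integral_shifted_sub hP x
  have e : Complex.exp (-(x - P / 2 + Real.pi * Complex.I) ^ 2 / (2 * P)) =
      gaussKernel P x (-(Real.pi * Complex.I)) := by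
    rw [gaussKernel]
    congr 3
    ring
  rw [stokesJump, e, stokesConst, eulerSum, gaussTransform, gaussTransform,
    eq_add_of_sub_eq h]
  ring

/-! ### Zeros of the `q`-sum close to `0` -/

theorem eulerSum_add_nat_mul {P : ℝ} (hP : 0 < P) (x : ℂ) (n : ℕ) :
    eulerSum P (x + n * (2 * Real.pi * Complex.I)) =
      eulerSum P x + ∑ j ∈ Finset.range n, stokesJump P (x + j * (2 * Real.pi * Complex.I)) := by
  induction n with
  | zero => simp
  | succ n ih =>
    rw [Finset.sum_range_succ, ← add_assoc, ← ih, ← eulerSum_add_two_pi_I hP]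
    congr 1
    push_cast
    ring

theorem norm_stokesJump (P : ℝ) (x : ℂ) :
    ‖stokesJump P x‖ = ‖stokesConst P‖ *
      Real.exp (((x.im + Real.pi) ^ 2 - (x.re - P / 2) ^ 2) / (2 * P)) := by
  rw [stokesJump, norm_mul, Complex.norm_exp]
  congr 2
  have : -(x - (P : ℂ) / 2 + Real.pi * Complex.I) ^ 2 / (2 * (P : ℂ)) =
      (-(x - ((P / 2 : ℝ) : ℂ) + Real.pi * Complex.I) ^ 2) / ((2 * P : ℝ) : ℂ) := by
    push_cast; ring
  rw [this, Complex.div_ofReal_re]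
  congr 1
  simp [pow_two]

theorem stokesConst_ne_zero {P : ℝ} (hP : 0 < P) : stokesConst P ≠ 0 := by
  refine div_ne_zero (neg_ne_zero.2 ?_) (sqrt_two_pi_mul_ne_zero hP)
  simp [Real.pi_ne_zero]

/-- Far from the positive axis only one exponential competes with the constant term. -/
theorem norm_eulerSum_sub_one_sub_stokesJump_le {P : ℝ} (hP : 0 < P) {z : ℂ} (hz : 0 ≤ z.im) :
    ‖eulerSum P (z + 2 * Real.pi * Complex.I) - 1 - stokesJump P z‖ ≤
      Real.exp z.re * Real.exp ((2 * Real.pi) ^ 2 / (2 * P)) +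
        ‖stokesJump P z‖ * (z.im * Real.exp (-(Real.pi / P) * z.im)) := by
  have hpi := Real.pi_gt_three
  -- Going back `m` turns brings `z` to a point `x` with `0 ≤ im x < 2π`, where the sum is close to
  -- `1`. Of the `m + 1` jumps accumulated on the way up, the last is the one at `z`.
  set m : ℕ := ⌊z.im / (2 * Real.pi)⌋₊ with hm
  have hm1 : m * (2 * Real.pi) ≤ z.im :=
    (le_div_iff₀ (by positivity)).1 (Nat.floor_le (by positivity))
  have hm2 : z.im < (m + 1) * (2 * Real.pi) :=
    (div_lt_iff₀ (by positivity)).1 (Nat.lt_floor_add_one _)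
  set x : ℂ := z - m * (2 * Real.pi * Complex.I) with hx
  have him : x.im = z.im - m * (2 * Real.pi) := by simp [hx]
  have hre : x.re = z.re := by simp [hx]
  have h1 := eulerSum_add_nat_mul hP x (m + 1)
  rw [Finset.sum_range_succ] at h1
  have e1 : x + ((m + 1 : ℕ) : ℂ) * (2 * Real.pi * Complex.I) = z + 2 * Real.pi * Complex.I := by
    rw [hx]; push_cast; ring
  have e2 : x + (m : ℂ) * (2 * Real.pi * Complex.I) = z := by rw [hx]; ring
  rw [e1, e2] at h1
  have h2 : eulerSum P (z + 2 * Real.pi * Complex.I) - 1 - stokesJump P z =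
      (eulerSum P x - 1) +
        ∑ j ∈ Finset.range m, stokesJump P (x + j * (2 * Real.pi * Complex.I)) := by
    rw [h1]; ring
  rw [h2]
  refine (norm_add_le _ _).trans (add_le_add ?_ ?_)
  · refine (norm_eulerSum_sub_one_le hP x).trans ?_
    rw [hre, him]
    have : (z.im - m * (2 * Real.pi)) ^ 2 ≤ (2 * Real.pi) ^ 2 :=
      pow_le_pow_left₀ (by linarith) (by linarith) 2
    gcongr
  · have h3 : ∀ j ∈ Finset.range m, ‖stokesJump P (x + j * (2 * Real.pi * Complex.I))‖ ≤
        ‖stokesJump P z‖ * Real.exp (-(Real.pi / P) * z.im) := by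
      intro j hj
      rw [norm_stokesJump, norm_stokesJump, mul_assoc ‖stokesConst P‖, ← Real.exp_add]
      refine mul_le_mul_of_nonneg_left (Real.exp_le_exp.2 ?_) (norm_nonneg _)
      have e3 : (x + j * (2 * Real.pi * Complex.I)).im = x.im + j * (2 * Real.pi) := by simp
      have e4 : (x + j * (2 * Real.pi * Complex.I)).re = x.re := by simp
      rw [e3, e4, him, hre]
      have hj1 : (j : ℝ) + 1 ≤ m := by exact_mod_cast Finset.mem_range.1 hj
      have hj0 : (0 : ℝ) ≤ j := Nat.cast_nonneg j
      -- An earlier jump sits lower by `w`, with `2π ≤ w ≤ im z`. This costs at least `2π im z` in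
      -- the square, hence a factor `exp (-(π/P) im z)`.
      set w : ℝ := (m - j) * (2 * Real.pi) with hw
      have hw1 : 2 * Real.pi ≤ w := by nlinarith
      have hw2 : w ≤ z.im := by nlinarith
      have e5 : z.im - m * (2 * Real.pi) + j * (2 * Real.pi) + Real.pi = z.im + Real.pi - w := by
        rw [hw]; ring
      have e6 : ((z.im + Real.pi) ^ 2 - (z.re - P / 2) ^ 2) / (2 * P) +
          -(Real.pi / P) * z.im =
          ((z.im + Real.pi) ^ 2 - (z.re - P / 2) ^ 2 - 2 * Real.pi * z.im) / (2 * P) := by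
        field_simp
        ring
      rw [e5, e6]
      refine div_le_div_of_nonneg_right ?_ (by positivity)
      nlinarith [mul_nonneg (sub_nonneg.2 hw1) hz, mul_nonneg (sub_nonneg.2 hw2)
        (by linarith : 0 ≤ w)]
    refine (norm_sum_le_of_le _ h3).trans ?_
    rw [Finset.sum_const, Finset.card_range, nsmul_eq_mul, mul_left_comm]
    have : (m : ℝ) ≤ z.im := by nlinarith [Nat.cast_nonneg (α := ℝ) m]
    gcongr

/-- The points at which the jump takes the value `-1`. -/
theorem exists_stokesConst_mul_exp_eq {P : ℝ} (hP : 0 < P) (B : ℝ) :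
    ∃ u : ℂ, u.re ≤ -B ∧ B ≤ u.im ∧
      stokesConst P * Complex.exp (-u ^ 2 / (2 * P)) = -1 := by
  have hP' : (P : ℂ) ≠ 0 := by exact_mod_cast hP.ne'
  set c : ℂ := Complex.log (-stokesConst P) with hc
  set N : ℝ := B ^ 2 + |2 * P * c.re| + 1 with hN
  have hN0 : 0 < N := by positivity
  -- For large `n`, `u²` is close to the negative imaginary axis, so the root in the upper
  -- half-plane points towards `e^{3πi/4}`.
  obtain ⟨n, hn⟩ := exists_nat_ge ((N + P * c.im) / (2 * Real.pi * P))
  rw [div_le_iff₀ (by have := Real.pi_pos; positivity)] at hn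
  obtain ⟨v, hv⟩ := IsAlgClosed.exists_pow_nat_eq
    (2 * P * (c - n * (2 * Real.pi * Complex.I))) (n := 2) (by norm_num)
  obtain ⟨u, hu, him⟩ : ∃ u : ℂ, u ^ 2 = 2 * P * (c - n * (2 * Real.pi * Complex.I)) ∧
      0 ≤ u.im := by
    rcases le_total 0 v.im with h | h
    · exact ⟨v, hv, h⟩
    · exact ⟨-v, by rw [neg_sq, hv], by simpa using h⟩
  have hre := congrArg Complex.re hu
  have him' := congrArg Complex.im hu
  simp [pow_two] at hre him'
  have h1 : N ≤ -u.re * u.im := by nlinarith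
  have h2 : u.re < 0 := by
    by_contra h
    push Not at h
    nlinarith [mul_nonneg h him]
  have h3 := neg_abs_le (2 * P * c.re)
  have h4 := le_abs_self (2 * P * c.re)
  -- If `a < B`, then `a²` and `b² = a² - D` are both at most `B² + |D|`, hence so is `ab`.
  have key : ∀ a b D : ℝ, 0 < a → 0 ≤ b → a * a - b * b = D → B ^ 2 + |D| + 1 ≤ a * b →
      B ≤ a := by
    intro a b D ha hb hD hab
    by_contra h
    push Not at h
    have h5 : b * b ≤ B ^ 2 + |D| := by nlinarith [neg_abs_le D]
    have h6 : a * a ≤ B ^ 2 + |D| := by nlinarith [abs_nonneg D]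
    nlinarith [sq_nonneg (a - b)]
  refine ⟨u, ?_, ?_, ?_⟩
  · have := key (-u.re) u.im (2 * P * c.re) (by linarith) him (by linarith) h1
    linarith
  · have h7 : 0 < u.im := by
      rcases him.lt_or_eq with h | h
      · exact h
      · rw [← h] at h1; linarith
    refine key u.im (-u.re) (-(2 * P * c.re)) h7 (by linarith) (by linarith) ?_
    rw [abs_neg]
    linarith
  · have h8 : -u ^ 2 / (2 * P) = -c + n * (2 * Real.pi * Complex.I) := by
      rw [hu]; field_simp; ring
    rw [h8, Complex.exp_add, Complex.exp_nat_mul_two_pi_mul_I, mul_one, Complex.exp_neg, hc,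
      Complex.exp_log (neg_ne_zero.2 (stokesConst_ne_zero hP))]
    field_simp [stokesConst_ne_zero hP]

/-- From `|e^w - 1 - w| ≤ |w|²`: the lower bound `|w| - |w|²` is smallest at the two endpoints,
where it equals `3/8 · 5/8`. -/
theorem le_norm_exp_sub_one {w : ℂ} (h1 : 3 / 8 ≤ ‖w‖) (h2 : ‖w‖ ≤ 5 / 8) :
    15 / 64 ≤ ‖Complex.exp w - 1‖ := by
  have h3 := Complex.norm_exp_sub_one_sub_id_le (x := w) (by linarith)
  have h4 := norm_sub_norm_le w (-(Complex.exp w - 1 - w))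
  rw [norm_neg, sub_neg_eq_add] at h4
  have e : w + (Complex.exp w - 1 - w) = Complex.exp w - 1 := by ring
  rw [e] at h4
  nlinarith

/-- The `q`-sum of the `q`-Euler series has zeros arbitrarily close to `0`. -/
theorem exists_eulerSum_eq_zero {P : ℝ} (hP : 0 < P) (M : ℝ) :
    ∃ x : ℂ, x.re < M ∧ eulerSum P x = 0 := by
  have hP' : (P : ℂ) ≠ 0 := by exact_mod_cast hP.ne'
  have hpi := Real.pi_pos
  have l1 : ∀ᶠ r : ℝ in atBot,
      Real.exp r * Real.exp ((2 * Real.pi) ^ 2 / (2 * P)) < 1 / 64 := by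
    have := Real.tendsto_exp_atBot.mul_const (Real.exp ((2 * Real.pi) ^ 2 / (2 * P)))
    rw [zero_mul] at this
    exact this.eventually_lt_const (by norm_num)
  have l2 : ∀ᶠ b : ℝ in atTop, b * Real.exp (-(Real.pi / P) * b) < 1 / 192 := by
    have := tendsto_rpow_mul_exp_neg_mul_atTop_nhds_zero 1 (Real.pi / P) (by positivity)
    simp only [Real.rpow_one] at this
    exact this.eventually_lt_const (by norm_num)
  obtain ⟨r₀, hr₀⟩ := eventually_atBot.1 l1
  obtain ⟨b₀, hb₀⟩ := eventually_atTop.1 l2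
  -- The four conditions make `u` large compared with `P`, put `im Z` beyond `b₀` and `0`, put `re
  -- Z` below `r₀`, and put it below `M`.
  obtain ⟨B, hB1, hB2, hB3, hB4⟩ : ∃ B : ℝ, P + 1 ≤ B ∧ max b₀ 0 + Real.pi + 1 ≤ B ∧
      P / 2 + 1 - r₀ ≤ B ∧ P / 2 + 2 - M ≤ B :=
    ⟨max (max (P + 1) (max b₀ 0 + Real.pi + 1)) (max (P / 2 + 1 - r₀) (P / 2 + 2 - M)),
      by simp, by simp, by simp, by simp⟩
  have hb₁ := le_max_left b₀ 0
  have hb₂ := le_max_right b₀ 0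
  obtain ⟨u, hure, huim, hu⟩ := exists_stokesConst_mul_exp_eq hP B
  have hun : P + 1 ≤ ‖u‖ :=
    hB1.trans (huim.trans ((le_abs_self _).trans (Complex.abs_im_le_norm u)))
  have hu0 : u ≠ 0 := norm_pos_iff.1 (by linarith)
  -- A local coordinate around a point where the jump is `-1`, scaled so that the jump becomes
  -- almost `-e^{-s}`. Thus `h(s)` is close to `1 - e^{-s}`, which vanishes at `s = 0`.
  set Z : ℂ → ℂ := fun s => u + P / 2 - Real.pi * Complex.I + P * s / u with hZ
  set h : ℂ → ℂ := fun s => eulerSum P (Z s + 2 * Real.pi * Complex.I) with hh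
  have hsmall : ∀ s : ℂ, ‖s‖ ≤ 1 / 2 → ‖(P : ℂ) * s / u‖ ≤ 1 := by
    intro s hs
    rw [norm_div, norm_mul, Complex.norm_real, Real.norm_of_nonneg hP.le,
      div_le_one (by linarith)]
    nlinarith
  have hZre : ∀ s : ℂ, ‖s‖ ≤ 1 / 2 → (Z s).re ≤ -B + P / 2 + 1 := by
    intro s hs
    have h1 := (Complex.re_le_norm _).trans (hsmall s hs)
    have h2 : (Z s).re = u.re + P / 2 + ((P : ℂ) * s / u).re := by
      rw [hZ]
      have : (u + (P : ℂ) / 2 - Real.pi * Complex.I + P * s / u) =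
        u + ((P / 2 : ℝ) : ℂ) - Real.pi * Complex.I + P * s / u := by push_cast; ring
      simp only [this, Complex.add_re, Complex.sub_re, Complex.ofReal_re]
      simp
    linarith
  have hZim : ∀ s : ℂ, ‖s‖ ≤ 1 / 2 → B - Real.pi - 1 ≤ (Z s).im := by
    intro s hs
    have h1 := neg_le_of_abs_le ((Complex.abs_im_le_norm _).trans (hsmall s hs))
    have h2 : (Z s).im = u.im - Real.pi + ((P : ℂ) * s / u).im := by
      rw [hZ]
      have : (u + (P : ℂ) / 2 - Real.pi * Complex.I + P * s / u) =
        u + ((P / 2 : ℝ) : ℂ) - Real.pi * Complex.I + P * s / u := by push_cast; ring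
      simp only [this, Complex.add_im, Complex.sub_im, Complex.ofReal_im]
      simp
    linarith
  have hJ : ∀ s : ℂ, stokesJump P (Z s) = -Complex.exp (-(s + P * s ^ 2 / (2 * u ^ 2))) := by
    intro s
    have h1 : -(Z s - P / 2 + Real.pi * Complex.I) ^ 2 / (2 * P) =
        -u ^ 2 / (2 * P) + -(s + P * s ^ 2 / (2 * u ^ 2)) := by
      simp only [hZ]
      field_simp
      ring
    rw [stokesJump, h1, Complex.exp_add, ← mul_assoc, hu]
    ring
  have hcor : ∀ s : ℂ, ‖s‖ ≤ 1 / 2 → ‖(P : ℂ) * s ^ 2 / (2 * u ^ 2)‖ ≤ 1 / 8 := by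
    intro s hs
    rw [norm_div, norm_mul, norm_mul, norm_pow, norm_pow, Complex.norm_real,
      Real.norm_of_nonneg hP.le, Complex.norm_two, div_le_iff₀ (by nlinarith)]
    have h1 : ‖s‖ ^ 2 ≤ 1 / 4 := by nlinarith [norm_nonneg s]
    have h2 : P ≤ ‖u‖ ^ 2 := by nlinarith
    nlinarith
  have hJn : ∀ s : ℂ, ‖s‖ ≤ 1 / 2 → ‖stokesJump P (Z s)‖ ≤ 3 := by
    intro s hs
    rw [hJ, norm_neg, Complex.norm_exp]
    have h1 : (-(s + P * s ^ 2 / (2 * u ^ 2))).re ≤ 1 := by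
      refine (Complex.re_le_norm _).trans ?_
      rw [norm_neg]
      linarith [norm_add_le s ((P : ℂ) * s ^ 2 / (2 * u ^ 2)), hcor s hs]
    have h2 := Real.exp_one_lt_d9
    linarith [Real.exp_le_exp.2 h1]
  have happ : ∀ s : ℂ, ‖s‖ ≤ 1 / 2 → ‖h s - 1 - stokesJump P (Z s)‖ ≤ 1 / 32 := by
    intro s hs
    have h1 := hr₀ (Z s).re (by linarith [hZre s hs])
    have him0 : 0 ≤ (Z s).im := by linarith [hZim s hs]
    have h2 := hb₀ (Z s).im (by linarith [hZim s hs])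
    refine (norm_eulerSum_sub_one_sub_stokesJump_le hP him0).trans ?_
    have h3 := mul_le_mul (hJn s hs) h2.le
      (mul_nonneg him0 (Real.exp_pos _).le) (by norm_num)
    linarith
  have hd : Differentiable ℂ h := by
    refine (differentiable_eulerSum hP).comp ?_
    simp only [hZ]
    fun_prop
  have hh0 : ‖h 0‖ ≤ 1 / 32 := by
    have h1 := happ 0 (by simp)
    rw [hJ] at h1
    simpa using h1
  -- `11/64 = 15/64 - 1/32 - 1/32`: the variation of the exponential minus the approximation errors
  -- at `s` and at `0`.
  have hsph : ∀ s ∈ Metric.sphere (0 : ℂ) (1 / 2), 11 / 64 ≤ ‖h s - h 0‖ := by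
    intro s hs
    have hs : ‖s‖ = 1 / 2 := by simpa using hs
    have h1 := happ s hs.le
    have h2 := hcor s hs.le
    have h3 := norm_add_le s ((P : ℂ) * s ^ 2 / (2 * u ^ 2))
    have h4 := norm_sub_norm_le s (-((P : ℂ) * s ^ 2 / (2 * u ^ 2)))
    rw [norm_neg, sub_neg_eq_add] at h4
    have h5 := le_norm_exp_sub_one (w := -(s + P * s ^ 2 / (2 * u ^ 2)))
      (by rw [norm_neg]; linarith) (by rw [norm_neg]; linarith)
    have h6 : Complex.exp (-(s + P * s ^ 2 / (2 * u ^ 2))) - 1 =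
        (h s - 1 - stokesJump P (Z s)) - (h s - h 0) - h 0 := by
      rw [hJ]; ring
    rw [h6] at h5
    have h7 := norm_sub_le ((h s - 1 - stokesJump P (Z s)) - (h s - h 0)) (h 0)
    have h8 := norm_sub_le (h s - 1 - stokesJump P (Z s)) (h s - h 0)
    linarith
  have hfreq : ∃ᶠ z in 𝓝 (0 : ℂ), h z ≠ h 0 := by
    intro hev
    have h1 : h =ᶠ[𝓝 0] fun _ => h 0 := by
      filter_upwards [hev] with z hz using not_not.1 hz
    have h2 := AnalyticOnNhd.eq_of_eventuallyEq
      (fun z _ => hd.analyticAt z) (fun z _ => analyticAt_const) h1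
    have h3 := hsph (1 / 2 : ℂ) (by simp)
    rw [congrFun h2 (1 / 2 : ℂ), sub_self, norm_zero] at h3
    norm_num at h3
  -- Quantitative open mapping: the image of the closed disc contains the disc of radius `11/128`
  -- about `h 0`, and `|h 0| ≤ 1/32`.
  obtain ⟨s, hs, hs0⟩ := hd.diffContOnCl.ball_subset_image_closedBall (by norm_num) hsph hfreq
    (show (0 : ℂ) ∈ Metric.ball (h 0) (11 / 64 / 2) by
      rw [Metric.mem_ball, dist_comm, dist_zero_right]; linarith)
  have hs : ‖s‖ ≤ 1 / 2 := by simpa using hs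
  refine ⟨_, ?_, hs0⟩
  have : (Z s + 2 * Real.pi * Complex.I).re = (Z s).re := by simp
  rw [this]
  linarith [hZre s hs]

/-! ### Obstruction to inversion -/

/-- A function which is continuous near `0` is not the inverse of the `q`-sum of the
`q`-Euler series. -/
theorem not_eqInvNearZero_eulerSum {P : ℝ} (hP : 0 < P) {F : LogSurface → ℂ} {R : ℝ} (hR : 0 < R)
    (hF : ContinuousOn F (disc R)) : ¬ EqInvNearZero F (eulerSum P) := by
  rintro ⟨R', hR', h⟩
  obtain ⟨x, hx, h0⟩ := exists_eulerSum_eq_zero hP (Real.log (min R R'))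
  have hx' : Real.exp x.re < min R R' := (Real.lt_log_iff_exp_lt (lt_min hR hR')).1 hx
  have hd := differentiable_eulerSum hP
  -- Zeros are isolated: the functional equation prevents the sum from vanishing identically.
  have hne : ∀ᶠ z in 𝓝[≠] x, eulerSum P z ≠ 0 := by
    rcases (hd.analyticAt x).eventually_eq_zero_or_eventually_ne_zero with h1 | h1
    · exfalso
      have h2 := AnalyticOnNhd.eq_of_eventuallyEq
        (fun z _ => hd.analyticAt z) (fun z _ => analyticAt_const (v := (0 : ℂ))) h1
      have h3 := eulerSum_functional_equation hP 0
      rw [h2] at h3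
      simp at h3
    · exact h1
  have h1 : ∀ᶠ z in 𝓝[≠] x, F z * eulerSum P z = 1 := by
    filter_upwards [hne, mem_nhdsWithin_of_mem_nhds ((isOpen_disc R').mem_nhds
      (show x ∈ disc R' from hx'.trans_le (min_le_right _ _)))] with z hz hz'
    rw [h z hz' hz, inv_mul_cancel₀ hz]
  -- The product is `1` around the zero `x`, while continuity of `F` forces the limit `F x * 0`.
  have h2 : Tendsto (fun z => F z * eulerSum P z) (𝓝[≠] x) (𝓝 (F x * eulerSum P x)) := by
    have hc : ContinuousAt F x := hF.continuousAt ((isOpen_disc R).mem_nhds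
      (show x ∈ disc R from hx'.trans_le (min_le_left _ _)))
    exact ((hc.mul (hd x).continuousAt).tendsto).mono_left nhdsWithin_le_nhds
  have h3 := tendsto_nhds_unique (tendsto_const_nhds.congr' (h1.mono fun _ h => h.symm)) h2
  rw [h0, mul_zero] at h3
  exact one_ne_zero h3

/-! ### Composition of `q`-Laplace transforms and orders from `1` on -/

/-- Variances add under convolution of Gaussians, and so do the shifts `P/2` and `V/2`. -/
theorem integral_gaussKernel_mul_gaussKernel {P V : ℝ} (hP : 0 < P) (hV : 0 < V) (x u : ℂ) :
    ∫ t : ℝ, gaussKernel P x t * gaussKernel V t u =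
      (Real.sqrt (2 * Real.pi * (P * V / (P + V))) : ℂ) * gaussKernel (P + V) x u := by
  have hP' : (P : ℂ) ≠ 0 := by exact_mod_cast hP.ne'
  have hV' : (V : ℂ) ≠ 0 := by exact_mod_cast hV.ne'
  have hPV : (P : ℂ) + V ≠ 0 := by exact_mod_cast (add_pos hP hV).ne'
  have hb : (-(1 / (2 * (P : ℂ)) + 1 / (2 * V))).re < 0 := by
    rw [neg_add, Complex.add_re]
    exact add_neg (neg_one_div_re hP) (neg_one_div_re hV)
  have e : ∀ t : ℝ, gaussKernel P x t * gaussKernel V t u =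
      Complex.exp (-(1 / (2 * (P : ℂ)) + 1 / (2 * V)) * (t : ℂ) ^ 2 +
        ((x - P / 2) / P + (V / 2 + u) / V) * t +
        (-(x - P / 2) ^ 2 / (2 * P) - (V / 2 + u) ^ 2 / (2 * V))) := by
    intro t
    rw [gaussKernel, gaussKernel, ← Complex.exp_add]
    congr 1
    field_simp
    ring
  have hb' : (2 : ℂ) * V + 2 * P ≠ 0 := by
    rw [← mul_add, add_comm]; exact mul_ne_zero two_ne_zero hPV
  have hVP : (V : ℂ) + P ≠ 0 := by rwa [add_comm]
  simp only [e]
  rw [integral_cexp_quadratic hb]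
  congr 1
  · rw [← ofReal_cpow_half (by positivity)]
    congr 1
    push_cast
    field_simp
    ring
  · rw [gaussKernel]
    congr 1
    push_cast
    field_simp
    ring

/-- Composition of `q`-Laplace transforms of different orders. -/
theorem gaussTransform_gaussTransform {P V : ℝ} (hP : 0 < P) (hV : 0 < V) {φ : ℂ → ℂ} {C : ℝ}
    (hc : Continuous fun t : ℝ => φ t) (hb : ∀ t : ℝ, ‖φ t‖ ≤ C) :
    gaussTransform P (gaussTransform V φ) = gaussTransform (P + V) φ := by
  funext x
  have hshift : ∀ t u : ℝ, gaussKernel V t u = gaussKernel V 0 ((u - t : ℝ) : ℂ) := by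
    intro t u
    unfold gaussKernel
    congr 3
    push_cast
    ring
  -- Fubini applies because `φ` is bounded and the two kernels form the integrand of a convolution
  -- of integrable functions.
  have hint : Integrable (Function.uncurry fun u t : ℝ =>
      φ u * (gaussKernel P x t * gaussKernel V t u)) (volume.prod volume) := by
    refine Integrable.bdd_mul (f := fun p : ℝ × ℝ => φ p.1)
      (g := fun p : ℝ × ℝ => gaussKernel P x p.2 * gaussKernel V p.2 p.1) (c := C) ?_
      (hc.comp continuous_fst).aestronglyMeasurable (Eventually.of_forall fun p => hb p.1)
    have h := (integrable_gaussKernel hP x).convolution_integrand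
      (ContinuousLinearMap.mul ℂ ℂ) (integrable_gaussKernel hV 0)
    simpa only [ContinuousLinearMap.mul_apply', hshift] using h
  have h1 : ∫ t : ℝ, gaussKernel P x t * ∫ u : ℝ, gaussKernel V t u * φ u =
      ∫ u : ℝ, φ u * ∫ t : ℝ, gaussKernel P x t * gaussKernel V t u := by
    have h := integral_integral_swap hint
    simp only [integral_const_mul] at h
    rw [h]
    refine integral_congr_ae (Eventually.of_forall fun t => ?_)
    simp only
    rw [← integral_const_mul]
    refine integral_congr_ae (Eventually.of_forall fun u => ?_)
    simp only
    ring
  have h2 : ∫ u : ℝ, φ u * ∫ t : ℝ, gaussKernel P x t * gaussKernel V t u =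
      (Real.sqrt (2 * Real.pi * (P * V / (P + V))) : ℂ) *
        ∫ u : ℝ, gaussKernel (P + V) x u * φ u := by
    rw [← integral_const_mul]
    refine integral_congr_ae (Eventually.of_forall fun u => ?_)
    simp only
    rw [integral_gaussKernel_mul_gaussKernel hP hV]
    ring
  have h3 : ∫ t : ℝ, gaussKernel P x t * gaussTransform V φ t =
      1 / (Real.sqrt (2 * Real.pi * V) : ℂ) *
        ∫ t : ℝ, gaussKernel P x t * ∫ u : ℝ, gaussKernel V t u * φ u := by
    rw [← integral_const_mul]
    refine integral_congr_ae (Eventually.of_forall fun t => ?_)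
    simp only [gaussTransform]
    ring
  have hPV : 0 < P + V := add_pos hP hV
  have h4 : Real.sqrt (2 * Real.pi * (P * V / (P + V))) * Real.sqrt (2 * Real.pi * (P + V)) =
      Real.sqrt (2 * Real.pi * P) * Real.sqrt (2 * Real.pi * V) := by
    rw [← Real.sqrt_mul (by positivity), ← Real.sqrt_mul (by positivity)]
    congr 1
    field_simp
  have h5 : (Real.sqrt (2 * Real.pi * (P * V / (P + V))) : ℂ) *
      (Real.sqrt (2 * Real.pi * (P + V)) : ℂ) =
      (Real.sqrt (2 * Real.pi * P) : ℂ) * (Real.sqrt (2 * Real.pi * V) : ℂ) := by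
    exact_mod_cast h4
  rw [gaussTransform, h3, h1, h2, gaussTransform, ← mul_assoc, ← mul_assoc]
  congr 1
  have n4 : (Real.sqrt (2 * Real.pi * (P * V / (P + V))) : ℂ) ≠ 0 :=
    sqrt_two_pi_mul_ne_zero (by positivity)
  rw [one_div_mul_one_div, ← h5, one_div, mul_inv, mul_right_comm, inv_mul_cancel₀ n4, one_mul,
    one_div]

theorem gaussTransform_eulerSum {P V : ℝ} (hP : 0 < P) (hV : 0 < V) :
    gaussTransform P (eulerSum V) = eulerSum (P + V) :=
  gaussTransform_gaussTransform hP hV continuous_logistic_ofReal norm_logistic_ofReal_le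

/-- Uniqueness of the analytic continuation along the direction `0`. -/
theorem Continues.eq_ofReal {g φ u : LogSurface → ℂ} {ε ε' R : ℝ} (hε : 0 < ε) (hε' : 0 < ε')
    (hR : 0 < R) (hφ : DifferentiableOn ℂ φ (sector 0 ε)) (hu : DifferentiableOn ℂ u (sector 0 ε'))
    (c : Continues 0 g φ) (hg : ∀ x ∈ disc R, g x = u x) (t : ℝ) : φ t = u t := by
  obtain ⟨δ, hδ, r, hr, h⟩ := c
  have hm : 0 < min R r := lt_min hR hr
  set z₀ : ℂ := ((Real.log (min R r / 2) : ℝ) : ℂ) with hz₀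
  have hz : z₀ ∈ disc (min R r) := by
    show Real.exp _ < _
    rw [hz₀, Complex.ofReal_re, Real.exp_log (half_pos hm)]
    exact half_lt_self hm
  have hA₁ : AnalyticOnNhd ℂ φ (sector 0 (min ε ε')) :=
    (hφ.mono (sector_mono (min_le_left _ _))).analyticOnNhd (isOpen_sector _ _)
  have hA₂ : AnalyticOnNhd ℂ u (sector 0 (min ε ε')) :=
    (hu.mono (sector_mono (min_le_right _ _))).analyticOnNhd (isOpen_sector _ _)
  refine hA₁.eqOn_of_preconnected_of_eventuallyEq hA₂ (convex_sector _ _).isPreconnected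
    (ofReal_mem_sector (lt_min hε hε') _ : z₀ ∈ _) ?_ (ofReal_mem_sector (lt_min hε hε') t)
  filter_upwards [(isOpen_sector 0 δ).mem_nhds (ofReal_mem_sector hδ _ : z₀ ∈ _),
    (isOpen_disc (min R r)).mem_nhds hz] with x x₁ x₂
  have x₂ : modulus x < min R r := x₂
  rw [h x ⟨x₁, x₂.trans_le (min_le_right _ _)⟩, hg x (x₂.trans_le (min_le_left _ _))]

theorem log_div_tilde (L : ℝ) (s s' : ℚ) :
    L / ((1 / (1 / s - 1 / s') : ℚ) : ℝ) = L * (1 / (s : ℝ) - 1 / (s' : ℝ)) := by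
  push_cast
  rw [div_div_eq_mul_div, div_one]

theorem mul_one_div_sub_pos {L : ℝ} (hL : 0 < L) {a b : ℚ} (ha : 0 < a) (hab : a < b) :
    0 < L * (1 / (a : ℝ) - 1 / (b : ℝ)) := by
  have h1 : (0 : ℝ) < a := by exact_mod_cast ha
  have h2 : (a : ℝ) < b := by exact_mod_cast hab
  exact mul_pos hL (sub_pos.2 (one_div_lt_one_div_of_lt h1 h2))

/-- The last stages of the summation of the `q`-Euler series. -/
theorem IsIteratedLaplace.eq_eulerSum_of_one_lt {q : ℝ} (hq : 1 < q) : ∀ (l : List ℚ) (s : ℚ)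
    {g F : LogSurface → ℂ} {R : ℝ}, IsOrder (s :: l) → 1 < s → 0 < R →
      (∀ x ∈ disc R, g x = eulerSum (Real.log q * (1 - 1 / (s : ℝ))) x) →
      IsIteratedLaplace q 0 (tilde (s :: l)) g F → F = eulerSum (Real.log q)
  | [], s, g, F, R, hs, h1, hR, hg, ⟨φ, ⟨ε, hε, hφ, _⟩, c, h⟩ => by
    have hL := Real.log_pos hq
    have hV : 0 < Real.log q * (1 - 1 / (s : ℝ)) := by
      simpa using mul_one_div_sub_pos hL one_pos h1
    have hs0 : (0 : ℝ) < s := by exact_mod_cast hs.2 s (by simp)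
    rw [show F = _ from h, laplace_zero (by linarith), gaussTransform_congr
      (c.eq_ofReal hε one_pos hR hφ (differentiable_eulerSum hV).differentiableOn hg),
      gaussTransform_eulerSum (div_pos hL hs0) hV]
    congr 1
    field_simp
    ring
  | s' :: l, s, g, F, R, hs, h1, hR, hg, ⟨φ, ⟨ε, hε, hφ, _⟩, c, h⟩ => by
    have hL := Real.log_pos hq
    have hV : 0 < Real.log q * (1 - 1 / (s : ℝ)) := by
      simpa using mul_one_div_sub_pos hL one_pos h1
    have hs0 := hs.2 s (by simp)
    have hss' : s < s' := List.rel_of_pairwise_cons hs.1 (by simp)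
    have hk := mul_one_div_sub_pos hL hs0 hss'
    rw [laplace_zero (by linarith), gaussTransform_congr
      (c.eq_ofReal hε one_pos hR hφ (differentiable_eulerSum hV).differentiableOn hg),
      log_div_tilde, gaussTransform_eulerSum hk hV] at h
    refine IsIteratedLaplace.eq_eulerSum_of_one_lt hq l s' (R := 1)
      ⟨hs.1.tail, fun a ha => hs.2 a (List.mem_cons_of_mem _ ha)⟩ (h1.trans hss') one_pos ?_ h
    -- The invariant moves to the next order: `L(1/s - 1/s') + L(1 - 1/s) = L(1 - 1/s')` with `L =
    -- log q`.
    intro x _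
    congr 1
    ring

/-- The first transform turns the logistic germ into `eulerSum` of parameter `L` or `L(1 - 1/s')`,
with `L = log q`; in the second case the later stages complete the parameter to `L`. -/
theorem IsIteratedLaplace.eq_eulerSum_of_one {q : ℝ} (hq : 1 < q) {l : List ℚ}
    {g F : LogSurface → ℂ} {R : ℝ} (hs : IsOrder (1 :: l)) (hR : 0 < R)
    (hg : ∀ x ∈ disc R, g x = logistic x)
    (hF : IsIteratedLaplace q 0 (tilde (1 :: l)) g F) : F = eulerSum (Real.log q) := by
  have hL := Real.log_pos hq
  cases l with
  | nil =>
    obtain ⟨φ, ⟨ε, hε, hφ, -⟩, c, h⟩ := hF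
    rw [show F = _ from h, laplace_zero (by linarith), gaussTransform_congr
      (c.eq_ofReal hε one_pos hR hφ differentiableOn_logistic hg)]
    simp [eulerSum]
  | cons s' l =>
    obtain ⟨φ, ⟨ε, hε, hφ, -⟩, c, h⟩ := hF
    have hss' : 1 < s' := List.rel_of_pairwise_cons hs.1 (by simp)
    rw [laplace_zero (by linarith), gaussTransform_congr
      (c.eq_ofReal hε one_pos hR hφ differentiableOn_logistic hg), log_div_tilde] at h
    refine IsIteratedLaplace.eq_eulerSum_of_one_lt hq l s' (R := 1)
      ⟨hs.1.tail, fun a ha => hs.2 a (List.mem_cons_of_mem _ ha)⟩ hss' one_pos ?_ h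
    intro x _
    simp [eulerSum]

/-! ### Partial theta functions and their growth -/

/-- The weights `p^{-n(n-1)/2}` for `log p = P`. -/
noncomputable def thetaWeight (P : ℝ) (n : ℕ) : ℝ := Real.exp (-(P * (n * (n - 1) / 2)))

theorem thetaWeight_pos (P : ℝ) (n : ℕ) : 0 < thetaWeight P n := Real.exp_pos _

theorem thetaWeight_zero_left (n : ℕ) : thetaWeight 0 n = 1 := by simp [thetaWeight]

theorem thetaWeight_zero (P : ℝ) : thetaWeight P 0 = 1 := by simp [thetaWeight]

theorem thetaWeight_succ (P : ℝ) (n : ℕ) :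
    thetaWeight P (n + 1) = thetaWeight P n * Real.exp (-(P * n)) := by
  rw [thetaWeight, thetaWeight, ← Real.exp_add]
  congr 1
  push_cast
  ring

theorem pow_triangle_eq (L : ℝ) (n : ℕ) :
    Real.exp L ^ (n * (n - 1) / 2) = thetaWeight (-L) n := by
  rw [← Nat.choose_two_right, thetaWeight, ← Real.exp_nat_mul, Nat.cast_choose_two]
  congr 1
  ring

/-- The power series `∑ (-1)ⁿ p^{-n(n-1)/2} ξⁿ` for `log p = P`, in the coordinate `log ξ`. -/
noncomputable def partialTheta (P : ℝ) (x : ℂ) : ℂ :=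
  ∑' n : ℕ, (-1) ^ n * (thetaWeight P n : ℂ) * Complex.exp x ^ n

theorem coeff_qEuler {q : ℝ} (hq : 0 < q) (n : ℕ) :
    PowerSeries.coeff n (qEuler q) = (-1) ^ n * (thetaWeight (-Real.log q) n : ℂ) := by
  rw [qEuler, PowerSeries.coeff_mk, ← pow_triangle_eq, Real.exp_log hq]
  push_cast
  rfl

theorem coeff_formalBorel_qEuler {q : ℝ} (hq : 0 < q) (s : ℝ) (n : ℕ) :
    PowerSeries.coeff n (formalBorel q s (qEuler q)) =
      (-1) ^ n * (thetaWeight (Real.log q * (1 / s - 1)) n : ℂ) := by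
  rw [formalBorel, PowerSeries.coeff_mk, coeff_qEuler hq, mul_div_assoc]
  congr 1
  have hb : 0 < base q s := Real.rpow_pos_of_pos hq _
  have h : thetaWeight (-Real.log q) n / base q s ^ (n * (n - 1) / 2) =
      thetaWeight (Real.log q * (1 / s - 1)) n := by
    rw [← Real.exp_log hb, pow_triangle_eq, log_base hq, thetaWeight, thetaWeight, thetaWeight,
      ← Real.exp_sub]
    congr 1
    ring
  rw [← h]
  push_cast
  rfl

theorem seriesSum_formalBorel_qEuler {q : ℝ} (hq : 0 < q) (s : ℝ) :
    seriesSum (formalBorel q s (qEuler q)) = partialTheta (Real.log q * (1 / s - 1)) := by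
  funext x
  simp only [seriesSum, partialTheta, coeff_formalBorel_qEuler hq, proj]

theorem tendsto_exp_neg_quadratic {α : ℝ} (hα : α < 0) (β γ : ℝ) :
    Tendsto (fun n : ℕ => Real.exp (α * n ^ 2 + β * n + γ)) atTop (𝓝 0) := by
  refine Real.tendsto_exp_atBot.comp ?_
  have h1 : Tendsto (fun n : ℕ => (n : ℝ)) atTop atTop := tendsto_natCast_atTop_atTop
  have h2 : Tendsto (fun n : ℕ => α * (n : ℝ) + β) atTop atBot :=
    tendsto_atBot_add_const_right _ _ (h1.const_mul_atTop_of_neg hα)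
  refine (tendsto_atBot_add_const_right _ γ (h1.atTop_mul_atBot₀ h2)).congr fun n => ?_
  ring

theorem summable_thetaWeight_mul_pow {P : ℝ} (hP : 0 < P) {r : ℝ} (hr : 0 < r) :
    Summable fun n : ℕ => thetaWeight P n * r ^ n := by
  refine summable_of_ratio_test_tendsto_lt_one (l := 0) one_pos
    (Eventually.of_forall fun n => (mul_pos (thetaWeight_pos P n) (pow_pos hr n)).ne') ?_
  have h1 : Tendsto (fun n : ℕ => Real.exp (-(P * n)) * r) atTop (𝓝 (0 * r)) := by
    refine Tendsto.mul_const r (Real.tendsto_exp_atBot.comp ?_)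
    exact tendsto_neg_atTop_atBot.comp (tendsto_natCast_atTop_atTop.const_mul_atTop hP)
  rw [zero_mul] at h1
  refine h1.congr fun n => ?_
  have h2 := thetaWeight_pos P n
  have h3 := pow_pos hr n
  have h4 := thetaWeight_pos P (n + 1)
  rw [Real.norm_of_nonneg (by positivity), Real.norm_of_nonneg (by positivity), thetaWeight_succ,
    pow_succ]
  field_simp

theorem norm_partialTheta_term (P : ℝ) (x : ℂ) (n : ℕ) :
    ‖(-1 : ℂ) ^ n * (thetaWeight P n : ℂ) * Complex.exp x ^ n‖ =
      thetaWeight P n * Real.exp x.re ^ n := by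
  rw [norm_mul, norm_mul, norm_pow, norm_neg, norm_one, one_pow, one_mul, norm_pow,
    Complex.norm_exp, Complex.norm_real, Real.norm_of_nonneg (thetaWeight_pos P n).le]

theorem summable_partialTheta {P : ℝ} (hP : 0 < P) (x : ℂ) :
    Summable fun n : ℕ => (-1 : ℂ) ^ n * (thetaWeight P n : ℂ) * Complex.exp x ^ n := by
  refine Summable.of_norm ?_
  simp only [norm_partialTheta_term]
  exact summable_thetaWeight_mul_pow hP (Real.exp_pos _)

theorem differentiable_partialTheta {P : ℝ} (hP : 0 < P) : Differentiable ℂ (partialTheta P) := by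
  intro x
  have hR : 0 < Real.exp (x.re + 1) := Real.exp_pos _
  refine (Complex.differentiableOn_tsum_of_summable_norm (summable_thetaWeight_mul_pow hP hR)
    (fun n => ?_) (isOpen_disc (Real.exp (x.re + 1))) fun n w hw => ?_).differentiableAt
      ((isOpen_disc _).mem_nhds ?_)
  · fun_prop
  · rw [norm_partialTheta_term]
    have hw : Real.exp w.re < Real.exp (x.re + 1) := hw
    have := thetaWeight_pos P n
    gcongr
  · exact Real.exp_lt_exp.2 (by linarith)

theorem partialTheta_functional_equation {P : ℝ} (hP : 0 < P) (x : ℂ) :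
    partialTheta P (x + P) = 1 - Complex.exp (x + P) * partialTheta P x := by
  rw [partialTheta, (summable_partialTheta hP _).tsum_eq_zero_add, sub_eq_add_neg, ← neg_mul,
    partialTheta, ← tsum_mul_left]
  congr 1
  · simp [thetaWeight_zero]
  · refine tsum_congr fun n => ?_
    rw [thetaWeight_succ]
    push_cast
    have h : Complex.exp (-(P * n)) * Complex.exp (P : ℂ) ^ n = 1 := by
      rw [← Complex.exp_nat_mul, ← Complex.exp_add]
      simp [mul_comm]
    rw [pow_succ (Complex.exp (x + P)), pow_succ (-1 : ℂ), Complex.exp_add, mul_pow]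
    linear_combination (-(-1 : ℂ) ^ n * thetaWeight P n * Complex.exp x ^ n * Complex.exp x *
      Complex.exp P) * h

theorem norm_partialTheta_le {P : ℝ} (hP : 0 < P) {x : ℂ} (hx : x.re ≤ 0) :
    ‖partialTheta P x‖ ≤ ∑' n : ℕ, thetaWeight P n := by
  have hs : Summable fun n : ℕ => thetaWeight P n := by
    simpa using summable_thetaWeight_mul_pow hP one_pos
  refine tsum_of_norm_bounded hs.hasSum fun n => ?_
  rw [norm_partialTheta_term]
  exact mul_le_of_le_one_right (thetaWeight_pos P n).le
    (pow_le_one₀ (Real.exp_pos _).le (Real.exp_le_one_iff.2 hx))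

theorem partialTheta_eq_ofReal (P : ℝ) {x : ℂ} {r : ℝ} (h : Complex.exp x = -(r : ℂ)) :
    partialTheta P x = ((∑' n : ℕ, thetaWeight P n * r ^ n : ℝ) : ℂ) := by
  rw [partialTheta, Complex.ofReal_tsum]
  refine tsum_congr fun n => ?_
  rw [h, neg_pow (r : ℂ)]
  have : (-1 : ℂ) ^ n * (-1) ^ n = 1 := by rw [← mul_pow]; simp
  push_cast
  linear_combination (thetaWeight P n : ℂ) * (r : ℂ) ^ n * this

/-- The Jacobi theta function `∑ (-1)ⁿ p^{-n(n-1)/2} ξⁿ` over `n ∈ ℤ`, for `log p = P`. -/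
noncomputable def fullTheta (P : ℝ) (x : ℂ) : ℂ :=
  partialTheta P x - Complex.exp (-x - P) * partialTheta P (-x - 2 * P)

theorem differentiable_fullTheta {P : ℝ} (hP : 0 < P) : Differentiable ℂ (fullTheta P) := by
  have h := differentiable_partialTheta hP
  refine h.sub (Differentiable.mul (by fun_prop) (h.comp (by fun_prop)))

/-- The inhomogeneous terms in the functional equations of the two halves cancel. -/
theorem fullTheta_add {P : ℝ} (hP : 0 < P) (x : ℂ) :
    fullTheta P (x + P) = -Complex.exp (x + P) * fullTheta P x := by
  have h1 := partialTheta_functional_equation hP x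
  have h2 := partialTheta_functional_equation hP (-x - 3 * P)
  have e1 : -x - 3 * (P : ℂ) + P = -x - 2 * P := by ring
  have e2 : -(x + (P : ℂ)) - 2 * P = -x - 3 * P := by ring
  have e3 : -(x + (P : ℂ)) - P = -x - 2 * P := by ring
  rw [e1] at h2
  have h3 : Complex.exp (x + P) * Complex.exp (-x - P) = 1 := by
    rw [← Complex.exp_add]; simp
  rw [fullTheta, fullTheta, e2, e3, h1]
  linear_combination h2 * (-1 : ℂ) + partialTheta P (-x - 2 * P) * (-h3)

theorem norm_fullTheta_add_nat_mul {P : ℝ} (hP : 0 < P) (t : ℝ) (n : ℕ) :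
    ‖fullTheta P ((t + n * P : ℝ) : ℂ)‖ =
      Real.exp (n * t + P * (n * (n + 1) / 2)) * ‖fullTheta P t‖ := by
  induction n with
  | zero => simp
  | succ n ih =>
    have e : ((t + (n + 1 : ℕ) * P : ℝ) : ℂ) = ((t + n * P : ℝ) : ℂ) + P := by push_cast; ring
    rw [e, fullTheta_add hP, norm_mul, norm_neg, ih, Complex.norm_exp, ← mul_assoc, ← Real.exp_add]
    congr 2
    rw [← Complex.ofReal_add, Complex.ofReal_re]
    push_cast
    ring

/-- At `ξ = -1` the alternating signs disappear and both halves contribute nonnegative reals, the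
first one positive. -/
theorem fullTheta_pi_mul_I_ne_zero {P : ℝ} (hP : 0 < P) : fullTheta P (Real.pi * Complex.I) ≠ 0 := by
  have h1 : Complex.exp (Real.pi * Complex.I) = -((1 : ℝ) : ℂ) := by
    rw [Complex.exp_pi_mul_I]; simp
  have h2 : ∀ y : ℝ, Complex.exp (-(Real.pi * Complex.I) - y) = -((Real.exp (-y) : ℝ) : ℂ) := by
    intro y
    rw [sub_eq_add_neg, Complex.exp_add, exp_neg_pi_I]
    push_cast
    ring
  have h3 := h2 (2 * P)
  push_cast at h3
  rw [fullTheta, h2, partialTheta_eq_ofReal P h1]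
  rw [partialTheta_eq_ofReal P (r := Real.exp (-(2 * P))) (by rw [h3]; push_cast; rfl)]
  have s1 := summable_thetaWeight_mul_pow hP one_pos
  have p1 : 0 < ∑' n : ℕ, thetaWeight P n * 1 ^ n :=
    s1.tsum_pos (fun n => by simpa using (thetaWeight_pos P n).le) 0
      (by simpa using thetaWeight_pos P 0)
  have p2 : 0 ≤ ∑' n : ℕ, thetaWeight P n * Real.exp (-(2 * P)) ^ n :=
    tsum_nonneg fun n => mul_nonneg (thetaWeight_pos P n).le (by positivity)
  rw [neg_mul, sub_neg_eq_add]
  have p3 := add_pos_of_pos_of_nonneg p1 (mul_nonneg (Real.exp_pos (-P)).le p2)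
  exact_mod_cast p3.ne'

/-- The partial theta function grows on the positive axis as fast as the theta function. -/
theorem not_partialTheta_growth {P P' : ℝ} (hP : 0 < P) (hPP' : P < P') {a C : ℝ}
    (h : ∀ᶠ t : ℝ in atTop, ‖partialTheta P t‖ ≤ C * Real.exp ((a + t) ^ 2 / (2 * P'))) :
    False := by
  have hP' : 0 < P' := hP.trans hPP'
  -- Along `t + nP` the assumed bound has `P²/(2P')` as coefficient of `n²` in its exponent, while
  -- the theta function has exactly `P/2`, which is larger.
  have hα : P ^ 2 / (2 * P') - P / 2 < 0 := by
    rw [sub_neg, div_lt_div_iff₀ (by positivity) (by positivity)]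
    nlinarith
  set C' : ℝ := ∑' n : ℕ, thetaWeight P n
  have hC' : 0 ≤ C' := tsum_nonneg fun n => (thetaWeight_pos P n).le
  -- The negative half of the theta function stays bounded, so the assumed bound passes to the whole
  -- function up to a constant. Dividing by the exact growth factor and letting `n → ∞` forces the
  -- value at `t` to vanish.
  have hzero : ∀ t : ℝ, fullTheta P t = 0 := by
    intro t
    have hseq : Tendsto (fun n : ℕ => t + n * P) atTop atTop :=
      tendsto_atTop_add_const_left _ _ (tendsto_natCast_atTop_atTop.atTop_mul_const hP)
    have l1 := (tendsto_exp_neg_quadratic hα ((a + t) * P / P' - t - P / 2)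
      ((a + t) ^ 2 / (2 * P'))).const_mul C
    have l2 := (tendsto_exp_neg_quadratic (show -(P / 2) < 0 by linarith) (-t - P / 2) 0).const_mul
      C'
    have l3 := l1.add l2
    simp only [mul_zero, add_zero] at l3
    refine norm_le_zero_iff.1 (ge_of_tendsto l3 ?_)
    filter_upwards [hseq.eventually h, hseq.eventually_ge_atTop 0] with n h1 h2
    have h3 : ‖fullTheta P ((t + n * P : ℝ) : ℂ)‖ ≤
        C * Real.exp ((a + (t + n * P)) ^ 2 / (2 * P')) + C' := by
      rw [fullTheta]
      refine (norm_sub_le _ _).trans (add_le_add h1 ?_)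
      rw [norm_mul, Complex.norm_exp]
      have e1 : (-((t + n * P : ℝ) : ℂ) - P).re = -(t + n * P) - P := by
        rw [← Complex.ofReal_neg, ← Complex.ofReal_sub, Complex.ofReal_re]
      have e2 : (-((t + n * P : ℝ) : ℂ) - 2 * P).re = -(t + n * P) - 2 * P := by
        have : (-((t + n * P : ℝ) : ℂ) - 2 * P) = ((-(t + n * P) - 2 * P : ℝ) : ℂ) := by
          push_cast; ring
        rw [this, Complex.ofReal_re]
      have h4 := norm_partialTheta_le hP (x := -((t + n * P : ℝ) : ℂ) - 2 * P)
        (by rw [e2]; linarith)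
      have h5 : Real.exp (-((t + n * P : ℝ) : ℂ) - P).re ≤ 1 :=
        Real.exp_le_one_iff.2 (by rw [e1]; linarith)
      calc _ ≤ 1 * C' := mul_le_mul h5 h4 (norm_nonneg _) zero_le_one
        _ = C' := one_mul _
    rw [norm_fullTheta_add_nat_mul hP, ← le_div_iff₀' (Real.exp_pos _), div_eq_mul_inv,
      ← Real.exp_neg, add_mul, mul_assoc, ← Real.exp_add] at h3
    refine h3.trans (le_of_eq ?_)
    congr 3
    · field_simp
      ring
    · ring_nf
  have hd := differentiable_fullTheta hP
  -- Vanishing on the real line would make the theta function identically zero, against its value at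
  -- `πi`.
  have hfreq : ∃ᶠ z in 𝓝[≠] (0 : ℂ), fullTheta P z = 0 := by
    have ht : Tendsto (fun t : ℝ => (t : ℂ)) (𝓝[≠] 0) (𝓝[≠] 0) := by
      refine tendsto_nhdsWithin_iff.2 ⟨?_, ?_⟩
      · exact (Complex.continuous_ofReal.tendsto' 0 0 (by simp)).mono_left nhdsWithin_le_nhds
      · filter_upwards [self_mem_nhdsWithin] with t ht
        simpa using ht
    exact ht.frequently (Eventually.of_forall hzero).frequently
  have h1 := AnalyticOnNhd.eqOn_of_preconnected_of_frequently_eq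
    (U := Set.univ) (fun z _ => hd.analyticAt z) (fun z _ => analyticAt_const (v := (0 : ℂ)))
    isPreconnected_univ (Set.mem_univ 0) hfreq
  exact fullTheta_pi_mul_I_ne_zero hP (h1 (Set.mem_univ _))

theorem partialTheta_zero_left {x : ℂ} (hx : x ∈ disc 1) : partialTheta 0 x = logistic x := by
  have h : ‖-Complex.exp x‖ < 1 := by
    rw [norm_neg, Complex.norm_exp]; exact hx
  have h2 := tsum_geometric_of_norm_lt_one h
  rw [sub_neg_eq_add] at h2
  rw [partialTheta, logistic, ← h2]
  refine tsum_congr fun n => ?_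
  rw [thetaWeight_zero_left, neg_pow (Complex.exp x)]
  simp

/-- The `q`-Laplace transform of the partial theta function, term by term. -/
theorem gaussTransform_partialTheta {P V : ℝ} (hV : 0 < V) (hVP : V ≤ P) {x : ℂ}
    (hx : x ∈ disc 1) : gaussTransform V (partialTheta P) x = partialTheta (P - V) x := by
  have hx : Real.exp x.re < 1 := hx
  set f : ℕ → ℝ → ℂ := fun n t => (-1) ^ n * (thetaWeight P n : ℂ) *
    (gaussKernel V x t * Complex.exp (((n : ℝ) : ℂ) * t)) with hf
  have hfi : ∀ n, Integrable (f n) := fun n =>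
    (integrable_gaussKernel_mul_exp hV x _).const_mul _
  have hw : ∀ n : ℕ, thetaWeight P n * Real.exp (V * (n * (n - 1) / 2)) =
      thetaWeight (P - V) n := by
    intro n
    rw [thetaWeight, thetaWeight, ← Real.exp_add]
    congr 1
    ring
  have hnorm : ∀ n, ∫ t : ℝ, ‖f n t‖ = (Real.exp (x.im ^ 2 / (2 * V)) *
      Real.sqrt (2 * Real.pi * V)) * (thetaWeight (P - V) n * Real.exp x.re ^ n) := by
    intro n
    simp only [hf, norm_mul ((-1 : ℂ) ^ n * (thetaWeight P n : ℂ))]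
    rw [integral_const_mul, integral_norm_gaussKernel_mul_exp hV, Real.exp_add, norm_mul, norm_pow,
      norm_neg, norm_one, one_pow, one_mul, Complex.norm_real,
      Real.norm_of_nonneg (thetaWeight_pos P n).le, ← hw, Real.exp_nat_mul]
    ring
  -- Since `V ≤ P`, the weights of parameter `P - V` are at most `1`, and a geometric series in `|x|
  -- < 1` dominates.
  have hsum : Summable fun n => ∫ t : ℝ, ‖f n t‖ := by
    simp only [hnorm]
    refine Summable.mul_left _ (Summable.of_nonneg_of_le (fun n => ?_) (fun n => ?_)
      (summable_geometric_of_lt_one (Real.exp_pos x.re).le hx))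
    · exact mul_nonneg (thetaWeight_pos _ n).le (by positivity)
    · refine mul_le_of_le_one_left (by positivity) (Real.exp_le_one_iff.2 ?_)
      rw [neg_nonpos, ← Nat.cast_choose_two]
      exact mul_nonneg (by linarith) (Nat.cast_nonneg _)
  have h := hasSum_integral_of_summable_integral_norm hfi hsum
  have e1 : ∀ t : ℝ, ∑' n, f n t = gaussKernel V x t * partialTheta P t := by
    intro t
    rw [partialTheta, ← tsum_mul_left]
    refine tsum_congr fun n => ?_
    simp only [hf]
    rw [Complex.ofReal_natCast, Complex.exp_nat_mul]
    ring
  simp only [e1] at h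
  rw [gaussTransform, ← h.tsum_eq, ← tsum_mul_left, partialTheta]
  refine tsum_congr fun n => ?_
  simp only [hf]
  rw [integral_const_mul, integral_gaussKernel_mul_exp hV, Complex.exp_add, ← hw,
    Complex.ofReal_natCast, Complex.exp_nat_mul]
  have := sqrt_two_pi_mul_ne_zero hV
  push_cast
  field_simp

theorem not_isConvergent_of_thetaWeight {P : ℝ} (hP : P < 0) {f : PowerSeries ℂ}
    (hf : ∀ n, PowerSeries.coeff n f = (-1) ^ n * (thetaWeight P n : ℂ)) : ¬ IsConvergent f := by
  rintro ⟨r, hr, h⟩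
  have h0 : 0 < r / 2 := by positivity
  have h1 := (h ((r / 2 : ℝ) : ℂ) (by
    rw [Complex.norm_real, Real.norm_of_nonneg h0.le]; linarith)).tendsto_atTop_zero.norm
  -- This sequence is the exact reciprocal of the modulus of the `n`-th term at `r/2`. Both would
  -- tend to `0`, although their product is `1`.
  have h2 := tendsto_exp_neg_quadratic (show P / 2 < 0 by linarith) (-P / 2 - Real.log (r / 2)) 0
  have h3 := h1.mul h2
  rw [norm_zero, zero_mul] at h3
  refine one_ne_zero (tendsto_nhds_unique (tendsto_const_nhds.congr fun n => ?_) h3)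
  rw [hf, norm_mul, norm_mul, norm_pow, norm_neg, norm_one, one_pow, one_mul, norm_pow,
    Complex.norm_real, Complex.norm_real, Real.norm_of_nonneg h0.le,
    Real.norm_of_nonneg (thetaWeight_pos P n).le]
  nth_rewrite 1 [← Real.exp_log h0]
  rw [← Real.exp_nat_mul, thetaWeight, ← Real.exp_add, ← Real.exp_add, eq_comm, Real.exp_eq_one_iff]
  ring

/-! ### Independence of the sequence of orders -/

/-- The first stages of the summation of the `q`-Euler series. -/
theorem IsIteratedLaplace.eq_eulerSum {q : ℝ} (hq : 1 < q) : ∀ (l : List ℚ) (s : ℚ)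
    {g F : LogSurface → ℂ}, IsOrder (s :: l) → s ≤ 1 →
      (∀ x ∈ disc 1, g x = partialTheta (Real.log q * (1 / (s : ℝ) - 1)) x) →
      IsIteratedLaplace q 0 (tilde (s :: l)) g F → F = eulerSum (Real.log q) := by
  have hL := Real.log_pos hq
  intro l
  induction l with
  | nil =>
    intro s g F hs hs1 hg hF
    rcases hs1.lt_or_eq with hlt | rfl
    -- Stopping at `s < 1` requires growth of parameter `L/s`, larger than the parameter `L(1/s -
    -- 1)` of the partial theta function, where `L = log q`.
    · exfalso
      obtain ⟨φ, hm, c, -⟩ := hF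
      have hP : 0 < Real.log q * (1 / (s : ℝ) - 1) := by
        simpa using mul_one_div_sub_pos hL (hs.2 s (by simp)) hlt
      obtain ⟨a, C, -, htop⟩ := hm.exists_bound hq
      obtain ⟨ε, hε, hφ, -⟩ := hm
      simp only [c.eq_ofReal hε one_pos one_pos hφ
        (differentiable_partialTheta hP).differentiableOn hg] at htop
      refine not_partialTheta_growth hP ?_ htop
      rw [div_eq_mul_one_div (Real.log q)]
      exact mul_lt_mul_of_pos_left (by linarith) hL
    · refine IsIteratedLaplace.eq_eulerSum_of_one hq hs one_pos (fun x hx => ?_) hF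
      rw [hg x hx, ← partialTheta_zero_left hx]
      simp
  | cons s' l ih =>
    intro s g F hs hs1 hg hF
    rcases hs1.lt_or_eq with hlt | rfl
    · obtain ⟨φ, hm, c, h⟩ := hF
      have hs0 := hs.2 s (by simp)
      have hP : 0 < Real.log q * (1 / (s : ℝ) - 1) := by
        simpa using mul_one_div_sub_pos hL hs0 hlt
      have hss' : s < s' := List.rel_of_pairwise_cons hs.1 (by simp)
      have hs'0 : (0 : ℝ) < s' := by exact_mod_cast hs0.trans hss'
      have hk := mul_one_div_sub_pos hL hs0 hss'
      obtain ⟨a, C, -, htop⟩ := hm.exists_bound hq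
      obtain ⟨ε, hε, hφ, -⟩ := hm
      have heq := c.eq_ofReal hε one_pos one_pos hφ
        (differentiable_partialTheta hP).differentiableOn hg
      rcases le_or_gt s' 1 with hs'1 | hs'1
      · refine ih s' ⟨hs.1.tail, fun a ha => hs.2 a (List.mem_cons_of_mem _ ha)⟩ hs'1 ?_ h
        intro x hx
        have h1 : 1 ≤ 1 / (s' : ℝ) := one_le_one_div hs'0 (by exact_mod_cast hs'1)
        rw [laplace_zero (by linarith), gaussTransform_congr heq, log_div_tilde,
          gaussTransform_partialTheta hk (mul_le_mul_of_nonneg_left (by linarith) hL.le) hx]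
        congr 1
        ring
      -- Passing from `s < 1` to `s' > 1` requires growth of parameter `L(1/s - 1/s')`, again larger
      -- than `L(1/s - 1)`.
      · exfalso
        simp only [heq, log_div_tilde] at htop
        refine not_partialTheta_growth hP (mul_lt_mul_of_pos_left ?_ hL) htop
        have h1 : 1 / (s' : ℝ) < 1 :=
          (div_lt_one hs'0).2 (by exact_mod_cast hs'1)
        linarith
    · refine IsIteratedLaplace.eq_eulerSum_of_one hq hs one_pos (fun x hx => ?_) hF
      rw [hg x hx, ← partialTheta_zero_left hx]
      simp

/-- The `q`-sum of the `q`-Euler series does not depend on the sequence of orders. -/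
theorem IsQMultisum.eq_eulerSum {q : ℝ} (hq : 1 < q) {s : List ℚ} (hs : IsOrder s)
    {G : LogSurface → ℂ} (h : IsQMultisum q 0 s (qEuler q) G) : G = eulerSum (Real.log q) := by
  have hL := Real.log_pos hq
  have hq0 : 0 < q := by linarith
  cases s with
  | nil => exact absurd h.1 (not_isConvergent_of_thetaWeight (by linarith) (coeff_qEuler hq0))
  | cons s l =>
    obtain ⟨hc, hF⟩ := h
    have hs0 : (0 : ℝ) < s := by exact_mod_cast hs.2 s (by simp)
    have hs1 : s ≤ 1 := by
      by_contra hlt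
      push Not at hlt
      refine not_isConvergent_of_thetaWeight ?_ (coeff_formalBorel_qEuler hq0 s) hc
      refine mul_neg_of_pos_of_neg hL (sub_neg.2 ((div_lt_one hs0).2 (by exact_mod_cast hlt)))
    rw [seriesSum_formalBorel_qEuler hq0] at hF
    exact IsIteratedLaplace.eq_eulerSum hq l s hs hs1 (fun _ _ => rfl) hF

/-! ### Summability of the `q`-Euler series and conclusion -/

theorem memE_logistic {q : ℝ} (hq : 1 < q) : MemE q 1 0 logistic := by
  refine ⟨1, one_pos, differentiableOn_logistic, 1, one_pos, 1, one_pos, 1,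
    fun ξ hξ _ => norm_logistic_le hξ, fun ξ hξ _ => ?_⟩
  refine mul_le_one₀ (norm_logistic_le hξ) (Real.exp_pos _).le (Real.exp_le_one_iff.2 ?_)
  rw [log_base (by linarith), div_one]
  have := Real.log_pos hq
  exact div_nonpos_of_nonpos_of_nonneg (neg_nonpos.2 (sq_nonneg _)) (by positivity)

theorem isQMultisummable_qEuler {q : ℝ} (hq : 1 < q) : IsQMultisummable q 0 [1] (qEuler q) := by
  have hq0 : 0 < q := by linarith
  refine ⟨laplace q ((1 : ℚ) : ℝ) 0 logistic, ⟨1, one_pos, fun z hz => ?_⟩, logistic,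
    by simpa using memE_logistic hq, ⟨1, one_pos, 1, one_pos, fun ξ hξ => ?_⟩, rfl⟩
  · refine Summable.of_norm ((summable_geometric_of_lt_one (norm_nonneg z) hz).congr fun n => ?_)
    rw [coeff_formalBorel_qEuler hq0]
    simp [thetaWeight]
  · rw [seriesSum_formalBorel_qEuler hq0, ← partialTheta_zero_left hξ.2]
    simp

theorem isOrder_singleton_one : IsOrder [1] := by simp [IsOrder]

/-- A `q`-multisum is never the inverse of the `q`-sum of the `q`-Euler series. -/
theorem IsQMultisum.not_eqInvNearZero {q : ℝ} (hq : 1 < q) {s : List ℚ} (hs : IsOrder s)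
    {f : PowerSeries ℂ} {F : LogSurface → ℂ} (h : IsQMultisum q 0 s f F) :
    ¬ EqInvNearZero F (eulerSum (Real.log q)) := by
  obtain ⟨R, hR, hc⟩ := h.continuousOn hq hs
  exact not_eqInvNearZero_eulerSum (Real.log_pos hq) hR hc

end QSummation

theorem mainTheorem4 (q : ℝ) (hq : 1 < q) :
    QSummation.IsQMultisummable q 0 [1] (QSummation.qEuler q) ∧
    (∀ s : List ℚ, QSummation.IsOrder s →
      ¬ ∃ (f : PowerSeries ℂ) (F G : QSummation.LogSurface → ℂ),
        QSummation.IsQMultisum q 0 s f F ∧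
        QSummation.IsQMultisum q 0 [1] (QSummation.qEuler q) G ∧
        QSummation.EqInvNearZero F G) ∧
    (∀ F G : QSummation.LogSurface → ℂ,
      QSummation.IsQSum q 0 (QSummation.qEuler q)⁻¹ F →
      QSummation.IsQSum q 0 (QSummation.qEuler q) G →
      ¬ QSummation.EqInvNearZero F G) := by
  refine ⟨QSummation.isQMultisummable_qEuler hq, ?_, ?_⟩
  · rintro s hs ⟨f, F, G, hF, hG, h⟩
    rw [hG.eq_eulerSum hq QSummation.isOrder_singleton_one] at h
    exact hF.not_eqInvNearZero hq hs h
  · rintro F G ⟨s, hs, hF⟩ ⟨s', hs', hG⟩ h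
    rw [hG.eq_eulerSum hq hs'] at h
    exact hF.not_eqInvNearZero hq hs h
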